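/- Let $\mathbb H$ be the hexagonal lattice embedded in $\mathbb R^2$ with elementary cells of side length $1$, and partition its sites into two sublattices $\mathcal A$, $\mathcal B$ so that the three neighbors of every site lie in the other sublattice. Make $\mathcal B$ a triangular lattice by joining two distinct sites of $\mathcal B$ whenever they are two steps apart in $\mathbb H$. Let $p\in[0,1]$ and let $\sigma^0\in\{-1,+1\}^{\mathbb H}$ have the Bernoulli product law with $P(\sigma^0_x=+1)=p$. Define $\sigma^n$, $n\ge 1$, from $\sigma^{n-1}$ by simultaneously updating the spins at all sites of $\mathcal A$ if $n$ is odd, and at all sites of $\mathcal B$ if $n$ is even, where updating the spin at $x$ means flipping it if and only if $2\sum_{y\sim x}\sigma_x\sigma_y<0$, i.e. if and only if it disagrees with the majority of its three neighbors. The limit $\sigma^\infty=\lim_{n\to\infty}\sigma^n$ exists almost surely. For a random configuration of spins on the sites of a graph, the cluster of a site $x$ is the set of sites reached from $x$ by paths all of whose sites (including $x$) have spin $+1$. Let $\theta_x(p,n)$ be the probability that the cluster of $x$ in $\sigma^n$ on $\mathbb H$ is infinite, and $\tau_{p,n}(x,y)$ the probability that $y$ is in the cluster of $x$. Let $\theta_x(p)$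 and $\tau_p(x,y)$ denote the same quantities for independent site percolation with density $p$ on the triangular lattice $\mathcal B$. A correlation length of a connectivity function $\tau$ is a number $\xi\in(0,\infty]$ with $$\xi^{-1}=\lim\Big\{-\frac{1}{\|x-y\|}\log\tau(x,y)\Big\},$$ the limit being over pairs of sites with $\|x-y\|\to\infty$ and, for the correlation length $\xi_u$ in the direction of a unit vector $u\in\mathbb R^2$, also $(y-x)/\|y-x\|\to u$. **Theorem.** There are constants $0<c_1,c_2,c_3,c_4<\infty$ such that for every $n\in[1,\infty]$ the following hold. For all $x,y\in\mathbb H$ there are $x',y'\in\mathcal B$ with $\|x-x'\|\le 1$ and $\|y-y'\|\le 1$ such that $$c_1\,\theta_{x'}(p)\le\theta_x(p,n)\le c_2\,\theta_{x'}(p)\quad\text{for all }p\in(1/2,1],$$ $$p^{c_3}\,\tau_p(x',y')\le\tau_{p,n}(x,y)\le p^{-c_4}\,\tau_p(x',y')\quad\text{for all }p\in(0,1/2].$$ For all $p\in(0,1/2]$ the correlation lengths agree: in every direction $u$ the correlation lengths $\xi_u(p,n)$ of $\tau_{p,n}$ and $\xi_u(p)$ of $\tau_p$ exist and $\xi_u(p,n)=\xi_u(p)$.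 Moreover, if the limit without restriction on the direction exists for one of $\tau_{p,n}$, $\tau_p$ and defines a correlation length $\xi$, then it exists for the other and defines the same $\xi$. -/

import Mathlib

open MeasureTheory ProbabilityTheory Filter Topology
open scoped ENNReal

noncomputable section

namespace Domany

/-! ### The hexagonal lattice and its triangular sublattice -/

/-- The Euclidean plane. -/
abbrev Plane : Type := EuclideanSpace ℝ (Fin 2)

/-- Sites of the hexagonal lattice, split into the two sublattices `𝒜` and `ℬ`; each sublattice
is indexed by its integer coordinates in a triangular lattice. -/
inductive HexSite : Type
  | A (z : ℤ × ℤ)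
  | B (z : ℤ × ℤ)

namespace HexSite

/-- The three neighbors of a site of the hexagonal lattice. -/
def nbr : HexSite → Fin 3 → HexSite
  | A (i, j) => ![B (i, j), B (i + 1, j), B (i, j + 1)]
  | B (i, j) => ![A (i, j), A (i - 1, j), A (i, j - 1)]

end HexSite

/-- The hexagonal lattice as a graph. -/
def hexGraph : SimpleGraph HexSite where
  Adj x y := ∃ k, x.nbr k = y
  symm := ⟨by
    rintro (⟨i, j⟩ | ⟨i, j⟩) y ⟨k, rfl⟩ <;> fin_cases k
    · exact ⟨0, by simp [HexSite.nbr]⟩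
    · exact ⟨1, by simp [HexSite.nbr]⟩
    · exact ⟨2, by simp [HexSite.nbr]⟩
    · exact ⟨0, by simp [HexSite.nbr]⟩
    · exact ⟨1, by simp [HexSite.nbr]⟩
    · exact ⟨2, by simp [HexSite.nbr]⟩⟩
  loopless := ⟨by
    rintro (⟨i, j⟩ | ⟨i, j⟩) ⟨k, hk⟩ <;> fin_cases k <;> simp [HexSite.nbr] at hk⟩

/-- The triangular lattice on the sublattice `ℬ`: the site `HexSite.B z` is written `z`, and two
distinct sites of `ℬ` are adjacent when they are two steps away from each other in the hexagonal
lattice. -/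
def triGraph : SimpleGraph (ℤ × ℤ) where
  Adj z w := z ≠ w ∧ ∃ a, hexGraph.Adj (HexSite.B z) a ∧ hexGraph.Adj a (HexSite.B w)
  symm := ⟨fun _ _ ⟨h, a, h₁, h₂⟩ => ⟨h.symm, a, h₂.symm, h₁.symm⟩⟩
  loopless := ⟨fun _ h => h.1 rfl⟩

/-- Position in the plane of the site of `ℬ` with coordinates `(i, j)`. -/
def triPos (z : ℤ × ℤ) : Plane :=
  !₂[√3 * ((z.1 : ℝ) + (z.2 : ℝ) / 2), 3 / 2 * (z.2 : ℝ)]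

/-- Position in the plane of a site of the hexagonal lattice with elementary cells of side
length `1`. -/
def hexPos : HexSite → Plane
  | HexSite.A z => triPos z + !₂[√3 / 2, 1 / 2]
  | HexSite.B z => triPos z

/-! ### The dynamics; the spin `+1` is `true`, the spin `-1` is `false` -/

/-- The value `±1` of a spin. -/
def spinVal (b : Bool) : ℤ := if b then 1 else -1

/-- The change of the Hamiltonian when the spin at `x` is flipped. -/
def energyChange (σ : HexSite → Bool) (x : HexSite) : ℤ :=
  2 * ∑ k, spinVal (σ x) * spinVal (σ (x.nbr k))

/-- The new spin at `x` when `x` is updated: flip if and only if this lowers the energy. -/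
def updatedSpin (σ : HexSite → Bool) (x : HexSite) : Bool :=
  if energyChange σ x < 0 then !(σ x) else σ x

/-- The update at time `n`: all sites of `𝒜` if `n` is odd, all sites of `ℬ` if `n` is even. -/
def updateAt (n : ℕ) (σ : HexSite → Bool) : HexSite → Bool
  | HexSite.A z => if Odd n then updatedSpin σ (HexSite.A z) else σ (HexSite.A z)
  | HexSite.B z => if Even n then updatedSpin σ (HexSite.B z) else σ (HexSite.B z)

/-- The state `σⁿ` at a finite time `n`, as a function of the initial state. -/
def state : ℕ → (HexSite → Bool) → (HexSite → Bool)
  | 0, σ => σ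
  | n + 1, σ => updateAt (n + 1) (state n σ)

open Classical in
/-- The limiting state `σ^∞`: a site is plus if its spin is eventually plus. (It is the limit of
`σⁿ` wherever that limit exists.) -/
def limitState (σ : HexSite → Bool) (x : HexSite) : Bool :=
  decide (∀ᶠ n in atTop, state n σ x = true)

/-- The state `σⁿ` at a time `n ∈ [0, ∞]`. -/
def stateAt : ℕ∞ → (HexSite → Bool) → (HexSite → Bool)
  | (n : ℕ) => state n
  | ⊤ => limitState

/-! ### Percolation -/

/-- The Bernoulli product measure with density `p` of plus spins. -/
def siteMeasure (V : Type) (p : unitInterval) : Measure (V → Bool) :=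
  Measure.infinitePi fun _ => bernoulliMeasure true false p

/-- The (plus) cluster of `x` in a configuration `ω`: the sites reached from `x` by plus paths.
It is empty if `x` is minus. -/
def cluster {V : Type} (G : SimpleGraph V) (ω : V → Bool) (x : V) : Set V :=
  {y | ∃ w : G.Walk x y, ∀ v ∈ w.support, ω v = true}

/-- The percolation probability at `x` of the random configuration `X`, defined on the probability
space `(Ω, P)`. -/
def percProb {V Ω : Type} [MeasurableSpace Ω] (G : SimpleGraph V) (P : Measure Ω)
    (X : Ω → V → Bool) (x : V) : ℝ :=
  P.real {ω | (cluster G (X ω) x).Infinite}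

/-- The connectivity function of the random configuration `X`. -/
def connectivity {V Ω : Type} [MeasurableSpace Ω] (G : SimpleGraph V) (P : Measure Ω)
    (X : Ω → V → Bool) (x y : V) : ℝ :=
  P.real {ω | y ∈ cluster G (X ω) x}

/-- `θ_x(p)` for independent site percolation on the triangular lattice. -/
def theta (p : unitInterval) (x : ℤ × ℤ) : ℝ :=
  percProb triGraph (siteMeasure (ℤ × ℤ) p) id x

/-- `τ_p(x, y)` for independent site percolation on the triangular lattice. -/
def tau (p : unitInterval) (x y : ℤ × ℤ) : ℝ :=
  connectivity triGraph (siteMeasure (ℤ × ℤ) p) id x y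

/-- `θ_x(p, n)` for the dependent model on the hexagonal lattice at time `n`. -/
def thetaAt (p : unitInterval) (n : ℕ∞) (x : HexSite) : ℝ :=
  percProb hexGraph (siteMeasure HexSite p) (stateAt n) x

/-- `τ_{p,n}(x, y)` for the dependent model on the hexagonal lattice at time `n`. -/
def tauAt (p : unitInterval) (n : ℕ∞) (x y : HexSite) : ℝ :=
  connectivity hexGraph (siteMeasure HexSite p) (stateAt n) x y

/-! ### Correlation lengths -/

/-- Pairs of sites `(x, y)` with `‖x - y‖ → ∞`. -/
def farPairs {V : Type} (pos : V → Plane) : Filter (V × V) :=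
  comap (fun q => ‖pos q.1 - pos q.2‖) atTop

/-- Pairs of sites `(x, y)` with `‖x - y‖ → ∞` and `(y - x) / ‖y - x‖ → u`. -/
def farPairsAlong {V : Type} (pos : V → Plane) (u : Plane) : Filter (V × V) :=
  farPairs pos ⊓ comap (fun q => ‖pos q.2 - pos q.1‖⁻¹ • (pos q.2 - pos q.1)) (𝓝 u)

/-- `ξ ∈ (0, ∞]` and `ξ⁻¹ = lim -log τ(x, y) / ‖x - y‖` along the filter `F` of pairs of sites
(with `∞⁻¹ = 0`); to be used where `τ > 0`. -/
def IsCorrLength {V : Type} (pos : V → Plane) (F : Filter (V × V)) (τ : V → V → ℝ)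
    (ξ : ℝ≥0∞) : Prop :=
  0 < ξ ∧
    Tendsto (fun q : V × V => -(1 / ‖pos q.1 - pos q.2‖ * Real.log (τ q.1 q.2))) F
      (𝓝 (ξ⁻¹).toReal)

end Domany

end

open MeasureTheory Filter Topology Domany
open scoped ENNReal

open MeasureTheory Filter Topology Domany
open scoped ENNReal

section

open ProbabilityTheory

namespace Domany

/-! ### Geometry of the hexagonal lattice -/

namespace HexSite

/-! The first update overwrites every spin of `𝒜` by the majority of its three neighbors in `ℬ`. So
from time 1 on the state is an increasing function of the initial spins on `ℬ` alone, and these form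
independent site percolation on the triangular lattice. The theorem reduces to two deterministic
comparisons between plus clusters at time `n` and initial triangular clusters, each losing only what
happens in one hexagon around `x` and one around `y`.

Nothing new gets connected: the evolutions of two separated sets of plus spins never interact
(`Separated.state`). Splitting the initial spins on `ℬ` into the clusters that meet the hexagon of
`x` and the rest shows that sites connected at time `n` have initially connected `ℬ`-sites in their
hexagons (`exists_near_connected`). Little gets disconnected: sites that stay plus stay connected
(`mem_cluster_update`), and a site whose hexagon is plus on `ℬ` stays plus forever
(`state_eq_of_near`), which gives `connected_of_nearPlus`. The limit exists for every initial state,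
because a weighted energy of finite total decreases by a fixed amount whenever a given site flips;
both comparisons then pass to time `∞`.

A hexagon has three sites in `ℬ`. By the Harris inequality, asking that the hexagons of `x` and `y`
be plus costs at most a factor `p ^ 3` each, whence the bounds on `θ` and `τ`. The logarithms of the
two connectivity functions thus differ by a bounded amount, which is negligible after division by
the distance. For the triangular lattice the directional limits exist because, by Harris and
translation invariance, `-log τ` is subadditive. -/

/-- Whether a site belongs to the sublattice `𝒜`. -/
def isA : HexSite → Bool
  | A _ => true
  | B _ => false

@[simp] theorem nbr_nbr_self (x : HexSite) (k : Fin 3) : (x.nbr k).nbr k = x := by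
  rcases x with ⟨i, j⟩ | ⟨i, j⟩ <;> fin_cases k <;> simp [nbr]

/-- Closing up a hexagon. -/
theorem nbr_comm (x : HexSite) (k l m : Fin 3) :
    ((x.nbr k).nbr m).nbr l = ((x.nbr l).nbr m).nbr k := by
  rcases x with ⟨i, j⟩ | ⟨i, j⟩ <;> fin_cases k <;> fin_cases l <;> fin_cases m <;>
    simp [nbr]

theorem nbr_injective (x : HexSite) : Function.Injective x.nbr := by
  intro k l h
  rcases x with ⟨i, j⟩ | ⟨i, j⟩ <;> fin_cases k <;> fin_cases l <;> simp [nbr] at h ⊢ <;> omega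

@[simp] theorem isA_nbr (x : HexSite) (k : Fin 3) : (x.nbr k).isA = !x.isA := by
  rcases x with ⟨i, j⟩ | ⟨i, j⟩ <;> fin_cases k <;> rfl

end HexSite

theorem hexGraph_adj_nbr (x : HexSite) (k : Fin 3) : hexGraph.Adj x (x.nbr k) := ⟨k, rfl⟩

/-! ### The majority rule -/

/-- The majority of the spins of the neighbors of a site. -/
def maj (σ : HexSite → Bool) (x : HexSite) : Bool :=
  (σ (x.nbr 0) && σ (x.nbr 1)) || (σ (x.nbr 1) && σ (x.nbr 2)) || (σ (x.nbr 0) && σ (x.nbr 2))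

theorem updatedSpin_eq_maj (σ : HexSite → Bool) (x : HexSite) : updatedSpin σ x = maj σ x := by
  simp only [updatedSpin, energyChange, maj, Fin.sum_univ_three]
  cases σ x <;> cases σ (x.nbr 0) <;> cases σ (x.nbr 1) <;> cases σ (x.nbr 2) <;> decide

theorem maj_eq_of {σ : HexSite → Bool} {x : HexSite} {k l : Fin 3} {b : Bool} (hkl : k ≠ l)
    (hk : σ (x.nbr k) = b) (hl : σ (x.nbr l) = b) : maj σ x = b := by
  unfold maj
  fin_cases k <;> fin_cases l <;> simp_all <;> cases b <;> simp_all

theorem exists_of_maj {σ : HexSite → Bool} {x : HexSite} {b : Bool} (h : maj σ x = b) :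
    ∃ k l, k ≠ l ∧ σ (x.nbr k) = b ∧ σ (x.nbr l) = b := by
  subst h
  unfold maj
  rcases h0 : σ (x.nbr 0) <;> rcases h1 : σ (x.nbr 1) <;> rcases h2 : σ (x.nbr 2)
  · exact ⟨0, 1, by decide, by simp [*], by simp [*]⟩
  · exact ⟨0, 1, by decide, by simp [*], by simp [*]⟩
  · exact ⟨0, 2, by decide, by simp [*], by simp [*]⟩
  · exact ⟨1, 2, by decide, by simp [*], by simp [*]⟩
  · exact ⟨1, 2, by decide, by simp [*], by simp [*]⟩
  · exact ⟨0, 2, by decide, by simp [*], by simp [*]⟩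
  · exact ⟨0, 1, by decide, by simp [*], by simp [*]⟩
  · exact ⟨0, 1, by decide, by simp [*], by simp [*]⟩

theorem maj_congr {σ τ : HexSite → Bool} {x : HexSite} (h : ∀ k, σ (x.nbr k) = τ (x.nbr k)) :
    maj σ x = maj τ x := by
  simp [maj, h]

theorem maj_mono {σ τ : HexSite → Bool} {x : HexSite}
    (h : ∀ k, σ (x.nbr k) = true → τ (x.nbr k) = true) (hx : maj σ x = true) :
    maj τ x = true := by
  obtain ⟨k, l, hkl, hk, hl⟩ := exists_of_maj hx
  exact maj_eq_of hkl (h k hk) (h l hl)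

/-- The simultaneous update of one of the sublattices: `𝒜` if `s = true`, `ℬ` otherwise. -/
def update (s : Bool) (σ : HexSite → Bool) (x : HexSite) : Bool :=
  if x.isA = s then maj σ x else σ x

theorem update_of_eq {s : Bool} {σ : HexSite → Bool} {x : HexSite} (h : x.isA = s) :
    update s σ x = maj σ x := if_pos h

theorem update_of_ne {s : Bool} {σ : HexSite → Bool} {x : HexSite} (h : x.isA = !s) :
    update s σ x = σ x := if_neg (by simp [h])

/-- The sublattice updated at time `n`. -/
def side (n : ℕ) : Bool := decide (Odd n)

theorem side_succ (n : ℕ) : side (n + 1) = !side n := by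
  simp only [side, Nat.odd_add_one, decide_not]

theorem state_succ (n : ℕ) (σ : HexSite → Bool) :
    state (n + 1) σ = update (side (n + 1)) (state n σ) := by
  funext x
  cases x <;> by_cases h : Odd (n + 1) <;>
    simp [state, updateAt, update, side, HexSite.isA, updatedSpin_eq_maj, h,
      ← Nat.not_odd_iff_even]

/-- The last updated sublattice agrees with the majority rule. -/
def Aligned (s : Bool) (σ : HexSite → Bool) : Prop := ∀ x, x.isA = s → σ x = maj σ x

theorem aligned_update (s : Bool) (σ : HexSite → Bool) : Aligned s (update s σ) := by
  intro x hx
  rw [update_of_eq hx]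
  exact maj_congr fun k => (update_of_ne (by simp [hx])).symm

theorem aligned_state (n : ℕ) (σ : HexSite → Bool) : Aligned (side (n + 1)) (state (n + 1) σ) := by
  rw [state_succ]
  exact aligned_update _ _

theorem update_mono {s : Bool} {σ τ : HexSite → Bool} (h : ∀ x, σ x = true → τ x = true)
    (x : HexSite) (hx : update s σ x = true) : update s τ x = true := by
  by_cases hs : x.isA = s
  · rw [update_of_eq hs] at hx ⊢
    exact maj_mono (fun _ => h _) hx
  · have hs' : x.isA = !s := by cases s <;> simpa using hs
    rw [update_of_ne hs'] at hx ⊢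
    exact h x hx

/-! ### Dependence on the initial spins of `ℬ` -/

theorem state_one_A (σ : HexSite → Bool) (z : ℤ × ℤ) :
    state 1 σ (HexSite.A z) = maj σ (HexSite.A z) := by
  rw [state_succ]
  exact update_of_eq (by simp [side, HexSite.isA])

theorem state_one_B (σ : HexSite → Bool) (z : ℤ × ℤ) :
    state 1 σ (HexSite.B z) = σ (HexSite.B z) := by
  rw [state_succ]
  exact update_of_ne (by simp [side, HexSite.isA])

theorem HexSite.exists_nbr_A (z : ℤ × ℤ) (k : Fin 3) :
    ∃ w, (HexSite.A z).nbr k = HexSite.B w := by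
  rcases h : (HexSite.A z).nbr k with w | w
  · have := HexSite.isA_nbr (HexSite.A z) k
    rw [h] at this
    simp [HexSite.isA] at this
  · exact ⟨w, rfl⟩

/-- The hypothesis concerns `ℬ` only, since the spins of `𝒜` are overwritten at time 1; this is also
why times start at `n + 1`. Applied in both directions it yields `state_ofB`. -/
theorem state_mono {σ τ : HexSite → Bool}
    (h : ∀ z, σ (HexSite.B z) = true → τ (HexSite.B z) = true) (n : ℕ) (x : HexSite)
    (hx : state (n + 1) σ x = true) : state (n + 1) τ x = true := by
  induction n generalizing x with
  | zero =>
    rcases x with z | z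
    · rw [zero_add, state_one_A] at hx ⊢
      refine maj_mono (fun k hk => ?_) hx
      obtain ⟨w, hw⟩ := HexSite.exists_nbr_A z k
      rw [hw] at hk ⊢
      exact h w hk
    · rw [zero_add, state_one_B] at hx ⊢
      exact h z hx
  | succ n ih =>
    rw [state_succ] at hx ⊢
    exact update_mono ih x hx

/-- The configuration with given spins on `ℬ` and minus spins on `𝒜`. -/
def ofB (β : ℤ × ℤ → Bool) : HexSite → Bool
  | HexSite.A _ => false
  | HexSite.B z => β z

theorem state_ofB (σ : HexSite → Bool) (n : ℕ) :
    state (n + 1) (ofB fun z => σ (HexSite.B z)) = state (n + 1) σ := by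
  funext x
  rw [Bool.eq_iff_iff]
  constructor <;> refine state_mono (fun z h => ?_) n x <;> simpa only [ofB] using h

/-! ### Stable hexagons -/

namespace HexSite

/-- The sites of `ℬ` in a hexagon that contains `x`. -/
def near : HexSite → Finset (ℤ × ℤ)
  | A (i, j) => {(i, j), (i - 1, j + 1), (i, j + 1)}
  | B (i, j) => {(i, j), (i + 1, j), (i + 1, j - 1)}

/-- A site of `ℬ` at distance at most `1` of `x`. -/
def base : HexSite → ℤ × ℤ
  | A z => z
  | B z => z

theorem base_mem_near (x : HexSite) : x.base ∈ x.near := by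
  rcases x with ⟨i, j⟩ | ⟨i, j⟩ <;> simp [near, base]

theorem card_near_le (x : HexSite) : x.near.card ≤ 3 := by
  rcases x with ⟨i, j⟩ | ⟨i, j⟩ <;> exact Finset.card_le_three

/-- The vertices of a hexagon that contains `x`. -/
def hexagon (x : HexSite) : Set HexSite :=
  {x, x.nbr 0, (x.nbr 0).nbr 1, ((x.nbr 0).nbr 1).nbr 2, (((x.nbr 0).nbr 1).nbr 2).nbr 0,
    ((((x.nbr 0).nbr 1).nbr 2).nbr 0).nbr 1}

/-- The walk from `x` in directions 0, 1, 2, 0, 1, 2 closes up, so the listed vertices form a cycle.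
Two equal neighbors fix the majority, so this makes a constant hexagon stable. -/
theorem exists_nbr_mem_hexagon {x y : HexSite} (hy : y ∈ x.hexagon) :
    ∃ k l, k ≠ l ∧ y.nbr k ∈ x.hexagon ∧ y.nbr l ∈ x.hexagon := by
  have h6 : (((((x.nbr 0).nbr 1).nbr 2).nbr 0).nbr 1).nbr 2 = x := by
    rw [nbr_comm (((x.nbr 0).nbr 1).nbr 2) 0 2 1, nbr_nbr_self, nbr_nbr_self, nbr_nbr_self]
  have h6' : x.nbr 2 = ((((x.nbr 0).nbr 1).nbr 2).nbr 0).nbr 1 := by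
    conv_lhs => rw [← h6, nbr_nbr_self]
  rcases hy with rfl | rfl | rfl | rfl | rfl | rfl
  · exact ⟨0, 2, by decide, by simp [hexagon], by rw [h6']; simp [hexagon]⟩
  · exact ⟨0, 1, by decide, by simp [hexagon], by simp [hexagon]⟩
  · exact ⟨1, 2, by decide, by simp [hexagon], by simp [hexagon]⟩
  · exact ⟨2, 0, by decide, by simp [hexagon], by simp [hexagon]⟩
  · exact ⟨0, 1, by decide, by simp [hexagon], by simp [hexagon]⟩
  · exact ⟨1, 2, by decide, by simp [hexagon], by rw [h6]; simp [hexagon]⟩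

theorem mem_near_of_mem_hexagon {x : HexSite} {z : ℤ × ℤ} (h : B z ∈ x.hexagon) :
    z ∈ x.near := by
  rcases z with ⟨a, b⟩
  rcases x with ⟨i, j⟩ | ⟨i, j⟩ <;> simp [hexagon, near, nbr] at h ⊢ <;> omega

end HexSite

theorem state_eq_of_near {σ : HexSite → Bool} {x : HexSite} {b : Bool}
    (h : ∀ z ∈ x.near, σ (HexSite.B z) = b) (n : ℕ) :
    ∀ y ∈ x.hexagon, state (n + 1) σ y = b := by
  induction n with
  | zero =>
    rintro (z | z) hy
    · rw [zero_add, state_one_A]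
      obtain ⟨k, l, hkl, hk, hl⟩ := HexSite.exists_nbr_mem_hexagon hy
      obtain ⟨v, hv⟩ := HexSite.exists_nbr_A z k
      obtain ⟨w, hw⟩ := HexSite.exists_nbr_A z l
      refine maj_eq_of hkl ?_ ?_
      · rw [hv] at hk ⊢
        exact h v (HexSite.mem_near_of_mem_hexagon hk)
      · rw [hw] at hl ⊢
        exact h w (HexSite.mem_near_of_mem_hexagon hl)
    · rw [zero_add, state_one_B]
      exact h z (HexSite.mem_near_of_mem_hexagon hy)
  | succ n ih =>
    intro y hy
    rw [state_succ, update]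
    split_ifs
    · obtain ⟨k, l, hkl, hk, hl⟩ := HexSite.exists_nbr_mem_hexagon hy
      exact maj_eq_of hkl (ih _ hk) (ih _ hl)
    · exact ih y hy

/-- A site whose hexagon is initially constant on `ℬ` keeps this spin from time `1` on. -/
theorem state_eq_self_of_near {σ : HexSite → Bool} {x : HexSite} {b : Bool}
    (h : ∀ z ∈ x.near, σ (HexSite.B z) = b) (n : ℕ) : state (n + 1) σ x = b :=
  state_eq_of_near h n x (by simp [HexSite.hexagon])

/-! ### Superposition of separated configurations -/

/-- Two configurations whose plus sites are neither equal nor adjacent. -/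
def Separated {V : Type} (G : SimpleGraph V) (u v : V → Bool) : Prop :=
  ∀ x y, u x = true → v y = true → x ≠ y ∧ ¬ G.Adj x y

theorem Separated.symm {V : Type} {G : SimpleGraph V} {u v : V → Bool} (h : Separated G u v) :
    Separated G v u := fun x y hx hy => ⟨(h y x hy hx).1.symm, fun e => (h y x hy hx).2 e.symm⟩

/-- `w` is the pointwise maximum of `u` and `v`. -/
def IsJoin {V : Type} (u v w : V → Bool) : Prop :=
  ∀ x, w x = true ↔ u x = true ∨ v x = true

theorem IsJoin.symm {V : Type} {u v w : V → Bool} (h : IsJoin u v w) : IsJoin v u w :=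
  fun x => (h x).trans or_comm

/-- If `u` has a plus neighbor of `d`, then a plus site `d` of the join is plus in `u`. -/
theorem Separated.of_adj {V : Type} {G : SimpleGraph V} {u v w : V → Bool}
    (h : Separated G u v) (hw : IsJoin u v w) {x y : V} (hx : u x = true) (hxy : G.Adj x y)
    (hy : w y = true) : u y = true :=
  ((hw y).1 hy).resolve_right fun hv => (h x y hx hv).2 hxy

theorem fin_three_eq_of_ne : ∀ i j k m : Fin 3, i ≠ j → i ≠ k → j ≠ k → m ≠ k → m ≠ i →
    m = j := by omega

theorem exists_third : ∀ k l : Fin 3, ∃ m, m ≠ k ∧ m ≠ l := by decide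

/-- Around a minus site the other two neighbors of an aligned plus neighbor are plus. -/
theorem plus_of_aligned {s : Bool} {w : HexSite → Bool} (hw : Aligned s w) {d : HexSite}
    (hd : d.isA = s) (hdw : w d = true) {k m : Fin 3} (hk : w (d.nbr k) = false) (hm : m ≠ k) :
    w (d.nbr m) = true := by
  rw [hw d hd] at hdw
  obtain ⟨i, j, hij, hi, hj⟩ := exists_of_maj hdw
  have hik : i ≠ k := by rintro rfl; simp [hk] at hi
  have hjk : j ≠ k := by rintro rfl; simp [hk] at hj
  by_cases hmi : m = i
  · rwa [hmi]
  · rwa [fin_three_eq_of_ne i j k m hij hik hjk hm hmi]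

/-- The heart of the non-interaction: a site `c` about to be updated never sees both configurations.
It would be minus, being adjacent to both. Alignment then forces plus spins onward from `c.nbr k`
and `c.nbr l` around a common hexagon, and these meet at the vertex opposite to `c`, where the two
configurations would touch. -/
theorem Separated.not_common_nbr {s : Bool} {u v w : HexSite → Bool}
    (h : Separated hexGraph u v) (hj : IsJoin u v w) (hw : Aligned s w) {c : HexSite}
    (hc : c.isA = !s) {k l : Fin 3} (hk : u (c.nbr k) = true) (hl : v (c.nbr l) = true) :
    False := by
  have hkl : k ≠ l := by
    rintro rfl
    exact (h _ _ hk hl).1 rfl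
  have hcw : w c = false := by
    by_contra hcw
    rw [Bool.not_eq_false] at hcw
    have h1 := h.of_adj hj hk (hexGraph_adj_nbr c k).symm hcw
    exact (h _ _ h1 hl).2 (hexGraph_adj_nbr c l)
  obtain ⟨m, hmk, hml⟩ := exists_third k l
  have hek : w ((c.nbr k).nbr m) = true :=
    plus_of_aligned hw (by simp [hc]) ((hj _).2 (Or.inl hk)) (k := k) (by simpa using hcw) hmk
  have hel : w ((c.nbr l).nbr m) = true :=
    plus_of_aligned hw (by simp [hc]) ((hj _).2 (Or.inr hl)) (k := l) (by simpa using hcw) hml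
  have huk := h.of_adj hj hk (hexGraph_adj_nbr _ m) hek
  have hvl := h.symm.of_adj hj.symm hl (hexGraph_adj_nbr _ m) hel
  -- `f` is the vertex opposite to `c` in the hexagon. It lies in the aligned sublattice and has two
  -- plus neighbors, one from `u` and one from `v`.
  set f := ((c.nbr k).nbr m).nbr l with hf
  have hf' : f = ((c.nbr l).nbr m).nbr k := HexSite.nbr_comm _ _ _ _
  have hfl : f.nbr l = (c.nbr k).nbr m := by simp [hf]
  have hfk : f.nbr k = (c.nbr l).nbr m := by simp [hf']
  have hfw : w f = true := by
    rw [hw f (by simp [hf, hc])]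
    exact maj_eq_of hkl (by rwa [hfk]) (by rwa [hfl])
  have hfu : u f = true := h.of_adj hj huk (by rw [hf]; exact hexGraph_adj_nbr _ _) hfw
  exact (h _ _ hfu hvl).2 (by rw [← hfk]; exact hexGraph_adj_nbr _ _)

/-- As no updated site sees plus spins of both configurations, each majority is decided by one of
them alone. -/
theorem Separated.update {s : Bool} {u v w : HexSite → Bool}
    (h : Separated hexGraph u v) (hj : IsJoin u v w) (hw : Aligned s w) :
    Separated hexGraph (update (!s) u) (update (!s) v) ∧
      IsJoin (update (!s) u) (update (!s) v) (update (!s) w) := by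
  have hcase : ∀ x : HexSite, x.isA = (!s) ∨ x.isA = !(!s) := fun x => by
    cases x.isA <;> cases s <;> simp
  have key : ∀ {c : HexSite}, c.isA = !s → ∀ {k l}, u (c.nbr k) = true → v (c.nbr l) = true →
      False := fun hc _ _ hk hl => h.not_common_nbr hj hw hc hk hl
  refine ⟨fun x y hx hy => ?_, fun x => ?_⟩
  · rcases hcase x with hxs | hxs <;> rcases hcase y with hys | hys
    · rw [update_of_eq hxs] at hx
      rw [update_of_eq hys] at hy
      obtain ⟨k, -, -, hk, -⟩ := exists_of_maj hx
      obtain ⟨l, -, -, hl, -⟩ := exists_of_maj hy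
      refine ⟨?_, ?_⟩
      · rintro rfl
        exact key hxs hk hl
      · rintro ⟨i, rfl⟩
        simp_all
    · rw [update_of_eq hxs] at hx
      rw [update_of_ne hys] at hy
      obtain ⟨k, -, -, hk, -⟩ := exists_of_maj hx
      refine ⟨?_, ?_⟩
      · rintro rfl
        simp_all
      · rintro ⟨i, rfl⟩
        exact key hxs hk hy
    · rw [update_of_ne hxs] at hx
      rw [update_of_eq hys] at hy
      obtain ⟨l, -, -, hl, -⟩ := exists_of_maj hy
      refine ⟨?_, ?_⟩
      · rintro rfl
        simp_all
      · intro hadj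
        obtain ⟨i, rfl⟩ := hadj.symm
        exact key hys hx hl
    · rw [update_of_ne hxs] at hx
      rw [update_of_ne hys] at hy
      exact h x y hx hy
  · rcases hcase x with hxs | hxs
    · rw [update_of_eq hxs, update_of_eq hxs, update_of_eq hxs]
      constructor
      · intro hx
        obtain ⟨k, l, hkl, hk, hl⟩ := exists_of_maj hx
        rcases (hj _).1 hk with hk | hk <;> rcases (hj _).1 hl with hl | hl
        · exact Or.inl (maj_eq_of hkl hk hl)
        · exact (key hxs hk hl).elim
        · exact (key hxs hl hk).elim
        · exact Or.inr (maj_eq_of hkl hk hl)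
      · rintro (hx | hx)
        · exact maj_mono (fun k hk => (hj _).2 (Or.inl hk)) hx
        · exact maj_mono (fun k hk => (hj _).2 (Or.inr hk)) hx
    · rw [update_of_ne hxs, update_of_ne hxs, update_of_ne hxs]
      exact hj x

/-- Two distinct sites of `ℬ` with a common neighbor are adjacent in the triangular lattice. -/
theorem triGraph_adj_of_nbr {x : HexSite} {z w : ℤ × ℤ} {k l : Fin 3} (hkl : k ≠ l)
    (hz : x.nbr k = HexSite.B z) (hw : x.nbr l = HexSite.B w) : triGraph.Adj z w := by
  refine ⟨?_, x, ?_, ?_⟩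
  · rintro rfl
    exact hkl (x.nbr_injective (hz.trans hw.symm))
  · rw [← hz]
    exact (hexGraph_adj_nbr _ _).symm
  · rw [← hw]
    exact hexGraph_adj_nbr _ _

/-- No alignment is available yet at time 0. Triangular adjacency replaces it: two neighbors of a
site of `𝒜` are equal or adjacent in `triGraph`, so that site cannot see both configurations. -/
theorem Separated.state_one {u v w : ℤ × ℤ → Bool} (h : Separated triGraph u v)
    (hj : IsJoin u v w) :
    Separated hexGraph (state 1 (ofB u)) (state 1 (ofB v)) ∧
      IsJoin (state 1 (ofB u)) (state 1 (ofB v)) (state 1 (ofB w)) := by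
  have key : ∀ {a} {k l}, ofB u ((HexSite.A a).nbr k) = true →
      ofB v ((HexSite.A a).nbr l) = true → False := by
    intro a k l hk hl
    obtain ⟨z, hz⟩ := HexSite.exists_nbr_A a k
    obtain ⟨y, hy⟩ := HexSite.exists_nbr_A a l
    rw [hz] at hk
    rw [hy] at hl
    rcases eq_or_ne k l with rfl | hkl
    · rw [hz] at hy
      cases hy
      exact (h z z hk hl).1 rfl
    · exact (h z y hk hl).2 (triGraph_adj_of_nbr hkl hz hy)
  refine ⟨?_, ?_⟩
  · rintro (a | a) (b | b) hx hy
    · rw [state_one_A] at hx hy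
      obtain ⟨k, -, -, hk, -⟩ := exists_of_maj hx
      obtain ⟨l, -, -, hl, -⟩ := exists_of_maj hy
      refine ⟨?_, ?_⟩
      · rintro ⟨⟩
        exact key hk hl
      · rintro ⟨i, hi⟩
        obtain ⟨c, hc⟩ := HexSite.exists_nbr_A a i
        simp [hc] at hi
    · rw [state_one_A] at hx
      rw [state_one_B] at hy
      obtain ⟨k, -, -, hk, -⟩ := exists_of_maj hx
      refine ⟨by simp, ?_⟩
      rintro ⟨i, hi⟩
      exact key hk (by rwa [hi])
    · rw [state_one_B] at hx
      rw [state_one_A] at hy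
      obtain ⟨l, -, -, hl, -⟩ := exists_of_maj hy
      refine ⟨by simp, fun hadj => ?_⟩
      obtain ⟨i, hi⟩ := hadj.symm
      exact key (by rwa [hi]) hl
    · rw [state_one_B] at hx hy
      refine ⟨?_, ?_⟩
      · rintro ⟨⟩
        exact (h _ _ hx hy).1 rfl
      · rintro ⟨i, hi⟩
        have := HexSite.isA_nbr (HexSite.B a) i
        rw [hi] at this
        simp [HexSite.isA] at this
  · have hj' : IsJoin (ofB u) (ofB v) (ofB w) := by
      rintro (z | z)
      · simp [ofB]
      · exact hj z
    rintro (a | a)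
    · rw [state_one_A, state_one_A, state_one_A]
      constructor
      · intro hx
        obtain ⟨k, l, hkl, hk, hl⟩ := exists_of_maj hx
        rcases (hj' _).1 hk with hk | hk <;> rcases (hj' _).1 hl with hl | hl
        · exact Or.inl (maj_eq_of hkl hk hl)
        · exact (key hk hl).elim
        · exact (key hl hk).elim
        · exact Or.inr (maj_eq_of hkl hk hl)
      · rintro (hx | hx)
        · exact maj_mono (fun k hk => (hj' _).2 (Or.inl hk)) hx
        · exact maj_mono (fun k hk => (hj' _).2 (Or.inr hk)) hx
    · rw [state_one_B, state_one_B, state_one_B]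
      exact hj a

/-- The evolutions of separated configurations stay separated and do not interact. -/
theorem Separated.state {u v w : ℤ × ℤ → Bool} (h : Separated triGraph u v)
    (hj : IsJoin u v w) (n : ℕ) :
    Separated hexGraph (state (n + 1) (ofB u)) (state (n + 1) (ofB v)) ∧
      IsJoin (state (n + 1) (ofB u)) (state (n + 1) (ofB v)) (state (n + 1) (ofB w)) := by
  induction n with
  | zero => exact h.state_one hj
  | succ n ih =>
    have := ih.1.update ih.2 (aligned_state n (ofB w))
    rwa [← side_succ, ← state_succ, ← state_succ, ← state_succ] at this


/-! ### Clusters -/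

section Cluster

variable {V : Type} {G : SimpleGraph V} {ω ω' : V → Bool} {x y z : V}

theorem mem_cluster_self (hx : ω x = true) : x ∈ cluster G ω x :=
  ⟨SimpleGraph.Walk.nil, by simpa using hx⟩

theorem plus_left_of_mem_cluster (h : y ∈ cluster G ω x) : ω x = true := by
  obtain ⟨w, hw⟩ := h
  exact hw x w.start_mem_support

theorem plus_of_mem_cluster (h : y ∈ cluster G ω x) : ω y = true := by
  obtain ⟨w, hw⟩ := h
  exact hw y w.end_mem_support

theorem mem_cluster_symm (h : y ∈ cluster G ω x) : x ∈ cluster G ω y := by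
  obtain ⟨w, hw⟩ := h
  exact ⟨w.reverse, by simpa using hw⟩

theorem mem_cluster_trans (h : y ∈ cluster G ω x) (h' : z ∈ cluster G ω y) :
    z ∈ cluster G ω x := by
  obtain ⟨w, hw⟩ := h
  obtain ⟨w', hw'⟩ := h'
  refine ⟨w.append w', fun v hv => ?_⟩
  rcases (SimpleGraph.Walk.mem_support_append_iff _ _).1 hv with hv | hv
  exacts [hw v hv, hw' v hv]

theorem mem_cluster_of_adj (hx : ω x = true) (hy : ω y = true) (h : G.Adj x y) :
    y ∈ cluster G ω x := by
  refine ⟨h.toWalk, fun v hv => ?_⟩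
  have : v = x ∨ v = y := by simpa using hv
  rcases this with rfl | rfl
  exacts [hx, hy]

theorem cluster_induction {motive : V → Prop} (hy : y ∈ cluster G ω x) (h0 : motive x)
    (hs : ∀ y z, motive y → ω y = true → G.Adj y z → ω z = true → motive z) : motive y := by
  obtain ⟨w, hw⟩ := hy
  induction w with
  | nil => exact h0
  | @cons u v t huv p ih =>
    have hw' : ∀ a ∈ p.support, ω a = true := fun a ha => hw a (by simp [ha])
    exact ih (hs _ _ h0 (hw u (by simp)) huv (hw' v p.start_mem_support)) hw'

theorem exists_adj_of_mem_cluster (hy : y ∈ cluster G ω x) (hne : x ≠ y) :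
    ∃ z, G.Adj x z ∧ z ∈ cluster G ω x ∧ y ∈ cluster G ω z := by
  obtain ⟨w, hw⟩ := hy
  cases w with
  | nil => exact (hne rfl).elim
  | @cons _ v _ h p =>
    have hp : ∀ a ∈ p.support, ω a = true := fun a ha => hw a (by simp [ha])
    exact ⟨v, h, mem_cluster_of_adj (hw x (by simp)) (hp v p.start_mem_support) h, p, hp⟩

theorem exists_finset_of_mem_cluster (hy : y ∈ cluster G ω x) :
    ∃ F : Finset V, (∀ v ∈ F, ω v = true) ∧
      ∀ ω' : V → Bool, (∀ v ∈ F, ω' v = true) → y ∈ cluster G ω' x := by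
  classical
  obtain ⟨w, hw⟩ := hy
  exact ⟨w.support.toFinset, by simpa using hw, fun ω' h => ⟨w, by simpa using h⟩⟩

theorem cluster_mono (h : ∀ v, ω v = true → ω' v = true) (hy : y ∈ cluster G ω x) :
    y ∈ cluster G ω' x := by
  obtain ⟨F, h1, h2⟩ := exists_finset_of_mem_cluster hy
  exact h2 ω' fun v hv => h v (h1 v hv)

end Cluster

/-! ### Convergence of the dynamics -/

/-- A summable weight on the hexagonal lattice that varies slowly. -/
noncomputable def siteWeight : HexSite → ℝ
  | HexSite.A z => (9 / 10) ^ z.1.natAbs * (9 / 10) ^ z.2.natAbs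
  | HexSite.B z => (9 / 10) ^ z.1.natAbs * (9 / 10) ^ z.2.natAbs

theorem siteWeight_pos (x : HexSite) : 0 < siteWeight x := by
  cases x <;> unfold siteWeight <;> positivity

theorem siteWeight_le_one (x : HexSite) : siteWeight x ≤ 1 := by
  cases x <;> unfold siteWeight <;>
    exact mul_le_one₀ (pow_le_one₀ (by norm_num) (by norm_num)) (by positivity)
      (pow_le_one₀ (by norm_num) (by norm_num))

theorem pow_natAbs_add_one (i : ℤ) :
    (9 / 10 : ℝ) * (9 / 10) ^ i.natAbs ≤ (9 / 10) ^ (i + 1).natAbs ∧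
      (9 / 10 : ℝ) * (9 / 10) ^ (i + 1).natAbs ≤ (9 / 10) ^ i.natAbs := by
  rw [← pow_succ', ← pow_succ']
  constructor <;> exact pow_le_pow_of_le_one (by norm_num) (by norm_num) (by omega)

theorem siteWeight_nbr_A (z : ℤ × ℤ) (k : Fin 3) :
    9 / 10 * siteWeight (HexSite.A z) ≤ siteWeight ((HexSite.A z).nbr k) ∧
      9 / 10 * siteWeight ((HexSite.A z).nbr k) ≤ siteWeight (HexSite.A z) := by
  obtain ⟨i, j⟩ := z
  have hi := pow_natAbs_add_one i
  have hj := pow_natAbs_add_one j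
  have hi0 : (0 : ℝ) < (9 / 10) ^ i.natAbs := by positivity
  have hj0 : (0 : ℝ) < (9 / 10) ^ j.natAbs := by positivity
  have hij := mul_pos hi0 hj0
  fin_cases k <;> simp [HexSite.nbr, siteWeight]
  · linarith
  · constructor <;> nlinarith [mul_le_mul_of_nonneg_right hi.1 hj0.le,
      mul_le_mul_of_nonneg_right hi.2 hj0.le]
  · constructor <;> nlinarith [mul_le_mul_of_nonneg_left hj.1 hi0.le,
      mul_le_mul_of_nonneg_left hj.2 hi0.le]

theorem siteWeight_nbr (x : HexSite) (k : Fin 3) :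
    9 / 10 * siteWeight x ≤ siteWeight (x.nbr k) ∧
      9 / 10 * siteWeight (x.nbr k) ≤ siteWeight x := by
  rcases x with z | z
  · exact siteWeight_nbr_A z k
  · rcases h : (HexSite.B z).nbr k with w | w
    · have := siteWeight_nbr_A w k
      rw [← h, HexSite.nbr_nbr_self] at this
      rw [← h]
      exact this.symm
    · have := HexSite.isA_nbr (HexSite.B z) k
      rw [h] at this
      simp [HexSite.isA] at this

theorem summable_pow_natAbs : Summable fun i : ℤ => (9 / 10 : ℝ) ^ i.natAbs := by
  have h : Summable fun n : ℕ => (9 / 10 : ℝ) ^ n :=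
    summable_geometric_of_lt_one (by norm_num) (by norm_num)
  exact Summable.of_nat_of_neg (by simpa using h) (by simpa using h)

/-- The sites of the hexagonal lattice as a disjoint union. -/
def HexSite.equivSum : (ℤ × ℤ) ⊕ (ℤ × ℤ) ≃ HexSite where
  toFun := Sum.elim HexSite.A HexSite.B
  invFun x := match x with
    | HexSite.A z => Sum.inl z
    | HexSite.B z => Sum.inr z
  left_inv := by rintro (z | z) <;> rfl
  right_inv := by rintro (z | z) <;> rfl

theorem summable_siteWeight : Summable siteWeight := by
  have h : Summable fun z : ℤ × ℤ => (9 / 10 : ℝ) ^ z.1.natAbs * (9 / 10 : ℝ) ^ z.2.natAbs :=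
    summable_pow_natAbs.mul_of_nonneg summable_pow_natAbs (fun _ => by positivity)
      (fun _ => by positivity)
  rw [← HexSite.equivSum.summable_iff]
  exact Summable.sum _ h h

/-- The weight of the edge at `x` in direction `k` if its endpoints disagree, and `0` otherwise. -/
noncomputable def edgeEnergy (σ : HexSite → Bool) (k : Fin 3) (x : HexSite) : ℝ :=
  if σ x = σ (x.nbr k) then 0 else siteWeight x * siteWeight (x.nbr k)

theorem edgeEnergy_nbr (σ : HexSite → Bool) (k : Fin 3) (x : HexSite) :
    edgeEnergy σ k (x.nbr k) = edgeEnergy σ k x := by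
  simp [edgeEnergy, eq_comm, mul_comm]

theorem edgeEnergy_nonneg (σ : HexSite → Bool) (k : Fin 3) (x : HexSite) :
    0 ≤ edgeEnergy σ k x := by
  unfold edgeEnergy
  split_ifs
  exacts [le_rfl, (mul_pos (siteWeight_pos _) (siteWeight_pos _)).le]

theorem edgeEnergy_le (σ : HexSite → Bool) (k : Fin 3) (x : HexSite) :
    edgeEnergy σ k x ≤ siteWeight x := by
  unfold edgeEnergy
  split_ifs
  exacts [(siteWeight_pos _).le,
    mul_le_of_le_one_right (siteWeight_pos _).le (siteWeight_le_one _)]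

/-- The edge energies seen from the sites of one sublattice. -/
noncomputable def sideEnergy (s : Bool) (σ : HexSite → Bool) (k : Fin 3) (x : HexSite) : ℝ :=
  if x.isA = s then edgeEnergy σ k x else 0

theorem summable_sideEnergy (s : Bool) (σ : HexSite → Bool) (k : Fin 3) :
    Summable (sideEnergy s σ k) := by
  refine Summable.of_nonneg_of_le (fun x => ?_) (fun x => ?_) summable_siteWeight <;>
    unfold sideEnergy <;> split_ifs
  exacts [edgeEnergy_nonneg _ _ _, le_rfl, edgeEnergy_le _ _ _, (siteWeight_pos _).le]

/-- The involution of the hexagonal lattice along the edges of one direction. -/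
def nbrEquiv (k : Fin 3) : HexSite ≃ HexSite where
  toFun x := x.nbr k
  invFun x := x.nbr k
  left_inv x := by simp
  right_inv x := by simp

/-- The total weighted energy. -/
noncomputable def weightedEnergy (s : Bool) (σ : HexSite → Bool) : ℝ :=
  ∑' x, ∑ k, sideEnergy s σ k x

/-- Every edge has one endpoint in each sublattice, so both sums run over all edges. Each update can
therefore be studied from the sublattice being updated, where the changes at different sites
decouple. -/
theorem weightedEnergy_not (s : Bool) (σ : HexSite → Bool) :
    weightedEnergy (!s) σ = weightedEnergy s σ := by
  unfold weightedEnergy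
  rw [Summable.tsum_finsetSum fun k _ => summable_sideEnergy _ _ _,
    Summable.tsum_finsetSum fun k _ => summable_sideEnergy _ _ _]
  refine Finset.sum_congr rfl fun k _ => ?_
  rw [← (nbrEquiv k).tsum_eq]
  refine tsum_congr fun x => ?_
  have : (nbrEquiv k) x = x.nbr k := rfl
  rw [this, sideEnergy, sideEnergy, edgeEnergy_nbr]
  simp

theorem weightedEnergy_nonneg (s : Bool) (σ : HexSite → Bool) : 0 ≤ weightedEnergy s σ := by
  refine tsum_nonneg fun x => Finset.sum_nonneg fun k _ => ?_
  unfold sideEnergy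
  split_ifs
  exacts [edgeEnergy_nonneg _ _ _, le_rfl]

/-- A flip at `x` repairs at least two edges and spoils at most one. Neighboring weights differ by a
factor of at most `10 / 9`, so the gain is at least `(2 * 9 / 10 - 10 / 9) * siteWeight x ^ 2`, more
than half of `siteWeight x ^ 2`. -/
theorem sum_sideEnergy_update (s : Bool) (σ : HexSite → Bool) (x : HexSite) :
    (∑ k, sideEnergy s (update s σ) k x) +
      (if update s σ x = σ x then 0 else siteWeight x ^ 2 / 2) ≤ ∑ k, sideEnergy s σ k x := by
  by_cases hx : x.isA = s
  · have hn : ∀ k, update s σ (x.nbr k) = σ (x.nbr k) := fun k => update_of_ne (by simp [hx])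
    have hu : update s σ x = maj σ x := update_of_eq hx
    have hw := siteWeight_pos x
    have h0 := siteWeight_nbr x 0
    have h1 := siteWeight_nbr x 1
    have h2 := siteWeight_nbr x 2
    simp only [sideEnergy, hx, if_true, Fin.sum_univ_three, edgeEnergy, hn, hu, maj]
    rcases σ x <;> rcases σ (x.nbr 0) <;> rcases σ (x.nbr 1) <;> rcases σ (x.nbr 2) <;>
      simp <;> nlinarith
  · have hx' : x.isA = !s := by cases s <;> simpa using hx
    simp [sideEnergy, hx, update_of_ne hx']

theorem weightedEnergy_update (s : Bool) (σ : HexSite → Bool) (x : HexSite) :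
    weightedEnergy s (update s σ) +
      (if update s σ x = σ x then 0 else siteWeight x ^ 2 / 2) ≤ weightedEnergy s σ := by
  have h1 : Summable fun x => ∑ k, sideEnergy s (update s σ) k x :=
    summable_sum fun k _ => summable_sideEnergy _ _ _
  have h2 : Summable fun x => ∑ k, sideEnergy s σ k x :=
    summable_sum fun k _ => summable_sideEnergy _ _ _
  have hd := h2.sub h1
  have key := hd.le_tsum x fun y _ => by
    have := sum_sideEnergy_update s σ y
    have h0 : (0 : ℝ) ≤ if update s σ y = σ y then 0 else siteWeight y ^ 2 / 2 := by
      split_ifs <;> positivity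
    linarith
  rw [h2.tsum_sub h1] at key
  have := sum_sideEnergy_update s σ x
  unfold weightedEnergy
  linarith

theorem weightedEnergy_eq (s t : Bool) (σ : HexSite → Bool) :
    weightedEnergy s σ = weightedEnergy t σ := by
  rcases Bool.eq_or_eq_not s t with rfl | rfl
  exacts [rfl, weightedEnergy_not _ _]

/-- The energy is nonincreasing and nonnegative, so its decrements tend to 0 and finally drop below
the price of a flip at `x`. -/
theorem eventually_state_succ_eq (σ : HexSite → Bool) (x : HexSite) :
    ∀ᶠ n in atTop, state (n + 1) σ x = state n σ x := by
  have hstep : ∀ n, weightedEnergy true (state (n + 1) σ) +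
      (if state (n + 1) σ x = state n σ x then 0 else siteWeight x ^ 2 / 2) ≤
        weightedEnergy true (state n σ) := fun n => by
    rw [state_succ, weightedEnergy_eq true (side (n + 1)),
      weightedEnergy_eq true (side (n + 1))]
    exact weightedEnergy_update _ _ _
  have hpos : 0 < siteWeight x ^ 2 / 2 := by have := siteWeight_pos x; positivity
  have hanti : Antitone fun n => weightedEnergy true (state n σ) := by
    refine antitone_nat_of_succ_le fun n => ?_
    have := hstep n
    split_ifs at this <;> linarith
  have hlim := tendsto_atTop_ciInf hanti
    ⟨0, by rintro _ ⟨n, rfl⟩; exact weightedEnergy_nonneg _ _⟩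
  have hdiff := hlim.sub (hlim.comp (tendsto_add_atTop_nat 1))
  rw [sub_self] at hdiff
  filter_upwards [hdiff.eventually_lt_const hpos] with n hn
  by_contra hne
  have := hstep n
  rw [if_neg hne] at this
  simp only [Function.comp_apply] at hn
  linarith

theorem limitState_eq_true {σ : HexSite → Bool} {x : HexSite} :
    limitState σ x = true ↔ ∀ᶠ n in atTop, state n σ x = true := by
  simp [limitState]

theorem eventually_state_eq_limitState (σ : HexSite → Bool) (x : HexSite) :
    ∀ᶠ n in atTop, state n σ x = limitState σ x := by
  obtain ⟨N, hN⟩ := eventually_atTop.1 (eventually_state_succ_eq σ x)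
  have hconst : ∀ n ≥ N, state n σ x = state N σ x := fun n hn =>
    Nat.le_induction rfl (fun m hm ih => (hN m hm).trans ih) n hn
  have hl : limitState σ x = state N σ x := by
    rcases h : state N σ x
    · rw [← Bool.not_eq_true, limitState_eq_true]
      intro hev
      obtain ⟨n, h1, h2⟩ := (hev.and (eventually_ge_atTop N)).exists
      rw [hconst n h2, h] at h1
      simp at h1
    · exact limitState_eq_true.2 (eventually_atTop.2 ⟨N, fun n hn => (hconst n hn).trans h⟩)
  filter_upwards [eventually_ge_atTop N] with n hn
  rw [hconst n hn, hl]

theorem tendsto_state (σ : HexSite → Bool) :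
    Tendsto (fun n : ℕ => state n σ) atTop (𝓝 (limitState σ)) := by
  rw [tendsto_pi_nhds]
  intro x
  exact tendsto_const_nhds.congr' ((eventually_state_eq_limitState σ x).mono fun n h => h.symm)

/-- On a finite set of sites the limit is attained at arbitrarily late times. -/
theorem eventually_state_eqOn (σ : HexSite → Bool) {S : Set HexSite} (hS : S.Finite) :
    ∀ᶠ n in atTop, ∀ x ∈ S, state n σ x = limitState σ x :=
  (eventually_all_finite hS).2 fun x _ => eventually_state_eq_limitState σ x

/-! ### Connections at later times come from connections at time zero -/

/-- Let `u` consist of the initial clusters meeting the hexagon of `x`, and `v` of the other plus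
spins. The evolution of `v` is minus at `x`, so `x` is plus in that of `u`, and by separation so is
all of its cluster. If `u` missed the hexagon of `y`, then `y` would be minus in the evolution of
`u`. -/
theorem exists_near_connected {σ : HexSite → Bool} {n : ℕ} {x y : HexSite}
    (hxy : y ∈ cluster hexGraph (state (n + 1) σ) x) :
    ∃ x' ∈ x.near, ∃ y' ∈ y.near, y' ∈ cluster triGraph (fun z => σ (HexSite.B z)) x' := by
  classical
  rw [← state_ofB] at hxy
  set β : ℤ × ℤ → Bool := fun z => σ (HexSite.B z) with hβ
  set u : ℤ × ℤ → Bool := fun z => decide (∃ x' ∈ x.near, z ∈ cluster triGraph β x') with hu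
  set v : ℤ × ℤ → Bool := fun z => β z && !u z with hv
  have hu' : ∀ {z}, u z = true ↔ ∃ x' ∈ x.near, z ∈ cluster triGraph β x' := by simp [hu]
  have huβ : ∀ {z}, u z = true → β z = true := fun hz => by
    obtain ⟨x', -, hx'⟩ := hu'.1 hz
    exact plus_of_mem_cluster hx'
  have hj : IsJoin u v β := fun z => by
    constructor
    · intro hz
      cases h : u z <;> simp [hv, h, hz]
    · rintro (hz | hz)
      · exact huβ hz
      · simp only [hv, Bool.and_eq_true] at hz
        exact hz.1
  have hsep : Separated triGraph u v := by
    intro z w hz hw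
    simp only [hv, Bool.and_eq_true, Bool.not_eq_true'] at hw
    refine ⟨?_, fun hadj => ?_⟩
    · rintro rfl
      simp [hz] at hw
    · obtain ⟨x', h1, h2⟩ := hu'.1 hz
      have := hu'.2 ⟨x', h1, mem_cluster_trans h2 (mem_cluster_of_adj (huβ hz) hw.1 hadj)⟩
      simp [this] at hw
  obtain ⟨hs, hjn⟩ := hsep.state hj n
  have hvx : state (n + 1) (ofB v) x = false := by
    refine state_eq_self_of_near (fun z hz => ?_) n
    change v z = false
    by_cases hz' : β z = true
    · have := hu'.2 ⟨z, hz, mem_cluster_self hz'⟩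
      simp [hv, this]
    · simp [hv, hz']
  have hux : state (n + 1) (ofB u) x = true := by
    refine ((hjn x).1 (plus_left_of_mem_cluster hxy)).resolve_right ?_
    simp [hvx]
  have huy : state (n + 1) (ofB u) y = true :=
    cluster_induction (motive := fun y => state (n + 1) (ofB u) y = true) hxy hux fun a b ha _ hab hb => hs.of_adj hjn ha hab hb
  by_contra hcon
  have : state (n + 1) (ofB u) y = false := by
    refine state_eq_self_of_near (fun z hz => ?_) n
    change u z = false
    by_contra hz'
    rw [Bool.not_eq_false] at hz'
    obtain ⟨x', h1, h2⟩ := hu'.1 hz'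
    exact hcon ⟨x', h1, z, hz, h2⟩
  simp [this] at huy

theorem eventually_mem_cluster {σ : HexSite → Bool} {x y : HexSite}
    (hxy : y ∈ cluster hexGraph (limitState σ) x) :
    ∀ᶠ n in atTop, y ∈ cluster hexGraph (state n σ) x := by
  obtain ⟨F, hF, hF'⟩ := exists_finset_of_mem_cluster hxy
  have : ∀ᶠ n in atTop, ∀ v ∈ F, state n σ v = true :=
    (Filter.eventually_all_finset F).2 fun v hv => limitState_eq_true.1 (hF v hv)
  exact this.mono fun n hn => hF' _ hn

theorem exists_near_connected_stateAt {σ : HexSite → Bool} {n : ℕ∞} (hn : 1 ≤ n) {x y : HexSite}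
    (hxy : y ∈ cluster hexGraph (stateAt n σ) x) :
    ∃ x' ∈ x.near, ∃ y' ∈ y.near, y' ∈ cluster triGraph (fun z => σ (HexSite.B z)) x' := by
  induction n using ENat.recTopCoe with
  | top =>
    obtain ⟨m, h1, h2⟩ := ((eventually_mem_cluster hxy).and (eventually_ge_atTop 1)).exists
    obtain ⟨m, rfl⟩ := Nat.exists_eq_add_of_le' h2
    exact exists_near_connected h1
  | coe n =>
    obtain ⟨m, rfl⟩ := Nat.exists_eq_add_of_le' (Nat.one_le_cast.1 hn)
    exact exists_near_connected hxy

theorem finite_setOf_mem_near (z : ℤ × ℤ) : {x : HexSite | z ∈ x.near}.Finite := by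
  obtain ⟨a, b⟩ := z
  refine Set.Finite.subset (s := {HexSite.A (a, b), HexSite.A (a + 1, b - 1),
    HexSite.A (a, b - 1), HexSite.B (a, b), HexSite.B (a - 1, b), HexSite.B (a - 1, b + 1)})
    (by simp) ?_
  rintro (⟨i, j⟩ | ⟨i, j⟩) h <;> simp [HexSite.near] at h ⊢ <;> omega

theorem finite_setOf_near_inter {S : Set (ℤ × ℤ)} (hS : S.Finite) :
    {x : HexSite | ∃ z ∈ x.near, z ∈ S}.Finite := by
  refine (hS.biUnion fun z _ => finite_setOf_mem_near z).subset ?_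
  rintro x ⟨z, hz, hzS⟩
  exact Set.mem_biUnion hzS hz

/-- Otherwise the finitely many initial clusters meeting the hexagon of `x` would cover a finite
set, and every site of the cluster of `x` would have a hexagon meeting it. -/
theorem exists_near_infinite {σ : HexSite → Bool} {n : ℕ∞} (hn : 1 ≤ n) {x : HexSite}
    (hx : (cluster hexGraph (stateAt n σ) x).Infinite) :
    ∃ x' ∈ x.near, (cluster triGraph (fun z => σ (HexSite.B z)) x').Infinite := by
  by_contra! hcon
  have hfin : (⋃ x' ∈ x.near, cluster triGraph (fun z => σ (HexSite.B z)) x').Finite :=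
    Set.Finite.biUnion (Finset.finite_toSet _) fun x' hx' => by
      simpa [Set.not_infinite] using hcon x' hx'
  refine hx ((finite_setOf_near_inter hfin).subset fun y hy => ?_)
  obtain ⟨x', hx', y', hy', h⟩ := exists_near_connected_stateAt hn hy
  exact ⟨y', hy', Set.mem_biUnion hx' h⟩

/-! ### Connections at time zero persist -/

/-- Paths alternate between the sublattices. Sites not updated keep their spin, and an updated site
between two distinct plus sites has a plus majority. Only an updated endpoint can be lost, so there
just a neighbor is reached. -/
theorem cluster_update_aux {s : Bool} {σ : HexSite → Bool} {d y : HexSite} (hd : d.isA = !s)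
    (h : y ∈ cluster hexGraph σ d) :
    (y.isA = (!s) → y ∈ cluster hexGraph (update s σ) d) ∧
      (y.isA = s → ∃ k, y.nbr k ∈ cluster hexGraph (update s σ) d) := by
  have hd0 : σ d = true := plus_left_of_mem_cluster h
  refine cluster_induction (motive := fun y =>
    (y.isA = (!s) → y ∈ cluster hexGraph (update s σ) d) ∧
      (y.isA = s → ∃ k, y.nbr k ∈ cluster hexGraph (update s σ) d)) h ?_ ?_
  · exact ⟨fun _ => mem_cluster_self (by rwa [update_of_ne hd]), fun hs => by simp [hd] at hs⟩
  · rintro a _ ⟨h1, h2⟩ ha ⟨k, rfl⟩ hb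
    refine ⟨fun hs => ?_, fun hs => ?_⟩
    · have has : a.isA = s := by simpa using hs
      obtain ⟨l, hl⟩ := h2 has
      rcases eq_or_ne k l with rfl | hkl
      · exact hl
      have hl0 : update s σ (a.nbr l) = true := plus_of_mem_cluster hl
      have hl1 : σ (a.nbr l) = true := by rwa [update_of_ne (by simp [has])] at hl0
      have ha' : update s σ a = true := by
        rw [update_of_eq has]
        exact maj_eq_of hkl hb hl1
      refine mem_cluster_trans hl (mem_cluster_trans
        (mem_cluster_of_adj hl0 ha' (hexGraph_adj_nbr a l).symm)
        (mem_cluster_of_adj ha' ?_ (hexGraph_adj_nbr a k)))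
      rwa [update_of_ne hs]
    · refine ⟨k, ?_⟩
      rw [HexSite.nbr_nbr_self]
      refine h1 ?_
      rw [← hs]
      simp

theorem isA_cases (s : Bool) (x : HexSite) : x.isA = s ∨ x.isA = !s := by
  cases x.isA <;> cases s <;> simp

/-- Two sites that stay plus stay connected. -/
theorem mem_cluster_update {s : Bool} {σ : HexSite → Bool} {x y : HexSite}
    (hx : update s σ x = true) (hy : update s σ y = true) (h : y ∈ cluster hexGraph σ x) :
    y ∈ cluster hexGraph (update s σ) x := by
  have key : ∀ {d}, d.isA = (!s) → y ∈ cluster hexGraph σ d →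
      y ∈ cluster hexGraph (update s σ) d := by
    intro d hd h
    have := cluster_update_aux hd h
    rcases isA_cases s y with hys | hys
    · obtain ⟨k, hk⟩ := this.2 hys
      exact mem_cluster_trans hk (mem_cluster_of_adj (plus_of_mem_cluster hk) hy
        (hexGraph_adj_nbr y k).symm)
    · exact this.1 hys
  rcases isA_cases s x with hxs | hxs
  · by_cases hxy : x = y
    · rw [← hxy]
      exact mem_cluster_self hx
    · obtain ⟨_, ⟨k, rfl⟩, -, h2⟩ := exists_adj_of_mem_cluster h hxy
      have h3 := key (by simp [hxs]) h2
      exact mem_cluster_trans (mem_cluster_of_adj hx (plus_left_of_mem_cluster h3)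
        (hexGraph_adj_nbr x k)) h3
  · exact key hxs h

/-- Each site of the cluster has a neighbor in it, so infinitely many of its sites lie in the
sublattice that is not updated; these stay plus, hence connected to `x`. -/
theorem infinite_cluster_update {s : Bool} {σ : HexSite → Bool} {x : HexSite}
    (hx : update s σ x = true) (h : (cluster hexGraph σ x).Infinite) :
    (cluster hexGraph (update s σ) x).Infinite := by
  have hnbr : ∀ y ∈ cluster hexGraph σ x, ∃ k, y.nbr k ∈ cluster hexGraph σ x := by
    intro y hy
    obtain ⟨z, hz, hzy⟩ := h.exists_notMem_finset {y}
    rw [Finset.mem_singleton] at hzy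
    obtain ⟨_, ⟨k, rfl⟩, h1, -⟩ :=
      exists_adj_of_mem_cluster (mem_cluster_trans (mem_cluster_symm hy) hz) (Ne.symm hzy)
    exact ⟨k, mem_cluster_trans hy h1⟩
  have hD : {y ∈ cluster hexGraph σ x | y.isA = !s}.Infinite := by
    intro hfin
    refine h ((hfin.union (Set.finite_iUnion fun k : Fin 3 =>
      hfin.image fun y => y.nbr k)).subset fun y hy => ?_)
    rcases isA_cases s y with hys | hys
    · obtain ⟨k, hk⟩ := hnbr y hy
      exact Or.inr (Set.mem_iUnion.2 ⟨k, y.nbr k, ⟨hk, by simp [hys]⟩, by simp⟩)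
    · exact Or.inl ⟨hy, hys⟩
  refine hD.mono ?_
  rintro y ⟨hy, hys⟩
  refine mem_cluster_update hx ?_ hy
  rw [update_of_ne hys]
  exact plus_of_mem_cluster hy

/-- The common neighbor in `𝒜` of two adjacent plus sites of `ℬ` has a plus majority at time 1. -/
theorem B_mem_cluster_state_one {σ : HexSite → Bool} {z w : ℤ × ℤ}
    (h : w ∈ cluster triGraph (fun z => σ (HexSite.B z)) z) :
    HexSite.B w ∈ cluster hexGraph (state 1 σ) (HexSite.B z) := by
  have hz : σ (HexSite.B z) = true := plus_left_of_mem_cluster (ω := fun z => σ (HexSite.B z)) h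
  refine cluster_induction (motive := fun w =>
    HexSite.B w ∈ cluster hexGraph (state 1 σ) (HexSite.B z)) h ?_ ?_
  · exact mem_cluster_self (by rwa [state_one_B])
  · rintro a b ih ha ⟨hne, c, hac, hcb⟩ hb
    have hbs : state 1 σ (HexSite.B b) = true := by rwa [state_one_B]
    have hcs : state 1 σ c = true := by
      obtain ⟨k, hk⟩ := hac.symm
      obtain ⟨l, hl⟩ := hcb
      have hkl : k ≠ l := by
        rintro rfl
        rw [hk] at hl
        cases hl
        exact hne rfl
      rcases c with c | c
      · rw [state_one_A]
        exact maj_eq_of hkl (by rw [hk]; exact ha) (by rw [hl]; exact hb)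
      · have := HexSite.isA_nbr (HexSite.B c) k
        rw [hk] at this
        simp [HexSite.isA] at this
    exact mem_cluster_trans ih (mem_cluster_trans
      (mem_cluster_of_adj (plus_of_mem_cluster ih) hcs hac) (mem_cluster_of_adj hcs hbs hcb))

/-- The hexagon at `x` is plus on `ℬ`. -/
def NearPlus (β : ℤ × ℤ → Bool) (x : HexSite) : Prop := ∀ z ∈ x.near, β z = true

theorem NearPlus.state {σ : HexSite → Bool} {x : HexSite}
    (h : NearPlus (fun z => σ (HexSite.B z)) x) (n : ℕ) : state (n + 1) σ x = true :=
  state_eq_self_of_near h n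

theorem base_mem_cluster_state_one {σ : HexSite → Bool} {x : HexSite}
    (h : NearPlus (fun z => σ (HexSite.B z)) x) :
    HexSite.B x.base ∈ cluster hexGraph (Domany.state 1 σ) x := by
  have hb : Domany.state 1 σ (HexSite.B x.base) = true := by
    rw [state_one_B]
    exact h _ x.base_mem_near
  rcases x with z | z
  · exact mem_cluster_of_adj (h.state 0) hb ⟨0, rfl⟩
  · exact mem_cluster_self (h.state 0)

theorem connected_of_nearPlus {σ : HexSite → Bool} {x y : HexSite}
    (hx : NearPlus (fun z => σ (HexSite.B z)) x) (hy : NearPlus (fun z => σ (HexSite.B z)) y)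
    (h : y.base ∈ cluster triGraph (fun z => σ (HexSite.B z)) x.base) (n : ℕ) :
    y ∈ cluster hexGraph (state (n + 1) σ) x := by
  induction n with
  | zero =>
    exact mem_cluster_trans (base_mem_cluster_state_one hx) (mem_cluster_trans
      (B_mem_cluster_state_one h) (mem_cluster_symm (base_mem_cluster_state_one hy)))
  | succ n ih =>
    have h1 := hx.state (n + 1)
    have h2 := hy.state (n + 1)
    rw [state_succ] at h1 h2 ⊢
    exact mem_cluster_update h1 h2 ih

theorem infinite_of_nearPlus {σ : HexSite → Bool} {x : HexSite}
    (hx : NearPlus (fun z => σ (HexSite.B z)) x)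
    (h : (cluster triGraph (fun z => σ (HexSite.B z)) x.base).Infinite) (n : ℕ) :
    (cluster hexGraph (state (n + 1) σ) x).Infinite := by
  induction n with
  | zero =>
    refine (h.image (f := HexSite.B) fun a _ b _ hab => by simpa using hab).mono ?_
    rintro _ ⟨z, hz, rfl⟩
    exact mem_cluster_trans (base_mem_cluster_state_one hx) (B_mem_cluster_state_one hz)
  | succ n ih =>
    have h1 := hx.state (n + 1)
    rw [state_succ] at h1 ⊢
    exact infinite_cluster_update h1 ih

theorem limitState_of_nearPlus {σ : HexSite → Bool} {x : HexSite}
    (hx : NearPlus (fun z => σ (HexSite.B z)) x) : limitState σ x = true := by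
  rw [limitState_eq_true]
  filter_upwards [eventually_ge_atTop 1] with n hn
  obtain ⟨m, rfl⟩ := Nat.exists_eq_add_of_le' hn
  exact hx.state m

/-- The path connecting `x` and `y` may change with time, so finite times do not suffice directly.
Keep only the plus spins of one initial path and of the two hexagons: this smaller state remains
within a fixed finite set, so it reaches its limit there at a finite time, and monotonicity carries
the connection over to `σ`. -/
theorem connected_limitState {σ : HexSite → Bool} {x y : HexSite}
    (hx : NearPlus (fun z => σ (HexSite.B z)) x) (hy : NearPlus (fun z => σ (HexSite.B z)) y)
    (h : y.base ∈ cluster triGraph (fun z => σ (HexSite.B z)) x.base) :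
    y ∈ cluster hexGraph (limitState σ) x := by
  classical
  obtain ⟨F, hF, hF'⟩ := exists_finset_of_mem_cluster h
  set S : Finset (ℤ × ℤ) := F ∪ (x.near ∪ y.near) with hS
  set σ' : HexSite → Bool := ofB fun z => decide (z ∈ S) with hσ'
  have hle : ∀ z, σ' (HexSite.B z) = true → σ (HexSite.B z) = true := by
    intro z hz
    have hz : z ∈ S := by simpa [hσ', ofB] using hz
    simp only [hS, Finset.mem_union] at hz
    rcases hz with hz | hz | hz
    exacts [hF z hz, hx z hz, hy z hz]
  have hmem : ∀ z ∈ S, σ' (HexSite.B z) = true := fun z hz => by simp [hσ', ofB, hz]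
  have hsupp : ∀ n v, state (n + 1) σ' v = true → ∃ z ∈ v.near, z ∈ (S : Set (ℤ × ℤ)) := by
    intro n v hv
    by_contra! hcon
    have : state (n + 1) σ' v = false :=
      state_eq_self_of_near (fun z hz => by simpa [hσ', ofB] using hcon z hz) n
    simp [this] at hv
  have hev := eventually_state_eqOn σ' (finite_setOf_near_inter S.finite_toSet)
  obtain ⟨n, h1, h2⟩ := (hev.and (eventually_ge_atTop 1)).exists
  obtain ⟨n, rfl⟩ := Nat.exists_eq_add_of_le' h2
  have hxy : y ∈ cluster hexGraph (state (n + 1) σ') x :=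
    connected_of_nearPlus (fun z hz => hmem z (by simp [hS, hz]))
      (fun z hz => hmem z (by simp [hS, hz]))
      (hF' _ fun z hz => hmem z (by simp [hS, hz])) n
  refine cluster_mono (fun v hv => ?_) hxy
  have hl : limitState σ' v = true := by rw [← h1 v (hsupp n v hv), hv]
  rw [limitState_eq_true] at hl ⊢
  filter_upwards [hl, eventually_ge_atTop 1] with m hm hm1
  obtain ⟨m, rfl⟩ := Nat.exists_eq_add_of_le' hm1
  exact state_mono hle m v hm

/-- If the limiting cluster were finite, then at some late time the state would agree with the limit
on it and on its neighbors, confining the cluster at that time to the same finite set. -/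
theorem infinite_limitState {σ : HexSite → Bool} {x : HexSite}
    (hx : NearPlus (fun z => σ (HexSite.B z)) x)
    (h : (cluster triGraph (fun z => σ (HexSite.B z)) x.base).Infinite) :
    (cluster hexGraph (limitState σ) x).Infinite := by
  intro hfin
  set K := cluster hexGraph (limitState σ) x with hK
  have hfin' : (K ∪ ⋃ k : Fin 3, (fun y => y.nbr k) '' K).Finite :=
    hfin.union (Set.finite_iUnion fun k => hfin.image _)
  obtain ⟨n, h1, h2⟩ :=
    ((eventually_state_eqOn σ hfin').and (eventually_ge_atTop 1)).exists
  obtain ⟨n, rfl⟩ := Nat.exists_eq_add_of_le' h2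
  refine infinite_of_nearPlus hx h n (hfin.subset fun y hy => ?_)
  refine cluster_induction hy (mem_cluster_self (limitState_of_nearPlus hx)) ?_
  rintro a _ ha _ ⟨k, rfl⟩ hb
  refine mem_cluster_trans ha (mem_cluster_of_adj (plus_of_mem_cluster ha) ?_
    (hexGraph_adj_nbr a k))
  rwa [← h1 _ (Or.inr (Set.mem_iUnion.2 ⟨k, a, ha, rfl⟩))]

theorem connected_stateAt {σ : HexSite → Bool} {n : ℕ∞} (hn : 1 ≤ n) {x y : HexSite}
    (hx : NearPlus (fun z => σ (HexSite.B z)) x) (hy : NearPlus (fun z => σ (HexSite.B z)) y)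
    (h : y.base ∈ cluster triGraph (fun z => σ (HexSite.B z)) x.base) :
    y ∈ cluster hexGraph (stateAt n σ) x := by
  induction n using ENat.recTopCoe with
  | top => exact connected_limitState hx hy h
  | coe n =>
    obtain ⟨m, rfl⟩ := Nat.exists_eq_add_of_le' (Nat.one_le_cast.1 hn)
    exact connected_of_nearPlus hx hy h m

theorem infinite_stateAt {σ : HexSite → Bool} {n : ℕ∞} (hn : 1 ≤ n) {x : HexSite}
    (hx : NearPlus (fun z => σ (HexSite.B z)) x)
    (h : (cluster triGraph (fun z => σ (HexSite.B z)) x.base).Infinite) :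
    (cluster hexGraph (stateAt n σ) x).Infinite := by
  induction n using ENat.recTopCoe with
  | top => exact infinite_limitState hx h
  | coe n =>
    obtain ⟨m, rfl⟩ := Nat.exists_eq_add_of_le' (Nat.one_le_cast.1 hn)
    exact infinite_of_nearPlus hx h m

/-- Any two sites of `ℬ` in a hexagon are equal or adjacent. -/
theorem near_connected {x : HexSite} {β : ℤ × ℤ → Bool} (h : NearPlus β x) {z w : ℤ × ℤ}
    (hz : z ∈ x.near) (hw : w ∈ x.near) : w ∈ cluster triGraph β z := by
  have hbase : ∀ z ∈ x.near, z = x.base ∨ triGraph.Adj x.base z := by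
    rintro ⟨a, b⟩ hz
    rcases x with ⟨i, j⟩ | ⟨i, j⟩ <;> simp [HexSite.near] at hz <;>
      rcases hz with ⟨rfl, rfl⟩ | ⟨rfl, rfl⟩ | ⟨rfl, rfl⟩
    · exact Or.inl rfl
    · exact Or.inr (triGraph_adj_of_nbr (x := HexSite.A (i - 1, j)) (k := 1) (l := 2) (by decide)
        (by simp [HexSite.nbr, HexSite.base]) (by simp [HexSite.nbr]))
    · exact Or.inr (triGraph_adj_of_nbr (x := HexSite.A (a, j)) (k := 0) (l := 2) (by decide)
        (by simp [HexSite.nbr, HexSite.base]) (by simp [HexSite.nbr]))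
    · exact Or.inl rfl
    · exact Or.inr (triGraph_adj_of_nbr (x := HexSite.A (i, b)) (k := 0) (l := 1) (by decide)
        (by simp [HexSite.nbr, HexSite.base]) (by simp [HexSite.nbr]))
    · exact Or.inr (triGraph_adj_of_nbr (x := HexSite.A (i, j - 1)) (k := 2) (l := 1) (by decide)
        (by simp [HexSite.nbr, HexSite.base]) (by simp [HexSite.nbr]))
  have hb : ∀ z ∈ x.near, z ∈ cluster triGraph β x.base := by
    intro z hz
    rcases hbase z hz with rfl | hadj
    · exact mem_cluster_self (h _ hz)
    · exact mem_cluster_of_adj (h _ x.base_mem_near) (h z hz) hadj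
  exact mem_cluster_trans (mem_cluster_symm (hb z hz)) (hb w hw)


/-! ### Increasing events and the Harris inequality -/

instance (V : Type) (p : unitInterval) : IsProbabilityMeasure (siteMeasure V p) :=
  inferInstanceAs (IsProbabilityMeasure (Measure.infinitePi _))

/-- Events that are witnessed by finitely many plus spins. -/
def Finitary {V : Type} (U : Set (V → Bool)) : Prop :=
  ∀ ω ∈ U, ∃ F : Finset V, (∀ v ∈ F, ω v = true) ∧
    ∀ ω' : V → Bool, (∀ v ∈ F, ω' v = true) → ω' ∈ U

section Harris

variable {V : Type} {U T : Set (V → Bool)}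

theorem Finitary.upper (hU : Finitary U) {ω ω' : V → Bool} (h : ∀ v, ω v = true → ω' v = true)
    (hω : ω ∈ U) : ω' ∈ U := by
  obtain ⟨F, h1, h2⟩ := hU ω hω
  exact h2 ω' fun v hv => h v (h1 v hv)

/-- The event that all spins in a finite set are plus. -/
def allPlus (F : Finset V) : Set (V → Bool) := {ω | ∀ v ∈ F, ω v = true}

theorem finitary_allPlus (F : Finset V) : Finitary (allPlus F) :=
  fun _ hω => ⟨F, hω, fun _ h => h⟩

theorem measurableSet_allPlus (F : Finset V) : MeasurableSet (allPlus F) := by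
  have : allPlus F = Set.pi (F : Set V) fun _ => {true} := by
    ext ω
    simp [allPlus, Set.mem_pi]
  rw [this]
  exact MeasurableSet.pi F.countable_toSet fun _ _ => measurableSet_singleton _

theorem siteMeasure_allPlus (p : unitInterval) (F : Finset V) :
    (siteMeasure V p).real (allPlus F) = (p : ℝ) ^ F.card := by
  have : allPlus F = Set.pi (F : Set V) fun _ => {true} := by
    ext ω
    simp [allPlus, Set.mem_pi]
  rw [this, measureReal_def, siteMeasure,
    Measure.infinitePi_pi _ fun _ _ => measurableSet_singleton _, Finset.prod_const,
    ENNReal.toReal_pow]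
  congr 1
  change (bernoulliMeasure true false p).real {true} = p
  exact bernoulliMeasure_real_apply_of_mem_of_notMem p (measurableSet_singleton _) (by simp)
    (by simp)

theorem finitary_connected (G : SimpleGraph V) (x y : V) :
    Finitary {ω | y ∈ cluster G ω x} :=
  fun _ hω => exists_finset_of_mem_cluster hω

theorem Finitary.iUnion {ι : Sort*} {W : ι → Set (V → Bool)} (h : ∀ i, Finitary (W i)) :
    Finitary (⋃ i, W i) := by
  intro ω hω
  obtain ⟨i, hi⟩ := Set.mem_iUnion.1 hω
  obtain ⟨F, h1, h2⟩ := h i ω hi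
  exact ⟨F, h1, fun ω' hω' => Set.mem_iUnion.2 ⟨i, h2 ω' hω'⟩⟩

theorem Finitary.measurableSet [Countable V] (hU : Finitary U) : MeasurableSet U := by
  have : U = ⋃ F : {F : Finset V // allPlus F ⊆ U}, allPlus F.1 := by
    ext ω
    simp only [Set.mem_iUnion]
    constructor
    · intro hω
      obtain ⟨F, h1, h2⟩ := hU ω hω
      exact ⟨⟨F, fun ω' h => h2 ω' h⟩, h1⟩
    · rintro ⟨⟨F, hF⟩, h⟩
      exact hF h
  rw [this]
  exact MeasurableSet.iUnion fun F => measurableSet_allPlus _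

/-- The lattice condition of `fkg` holds with equality: in each coordinate the minimum and the
maximum are the two given spins in some order. -/
theorem harris_fintype {ι : Type} [Fintype ι] (m : Measure Bool) [IsProbabilityMeasure m]
    {S T : Set (ι → Bool)} (hS : IsUpperSet S) (hT : IsUpperSet T) :
    (Measure.pi fun _ : ι => m).real S * (Measure.pi fun _ : ι => m).real T ≤
      (Measure.pi fun _ : ι => m).real (S ∩ T) := by
  classical
  set P := Measure.pi fun _ : ι => m with hP
  have hsum : ∀ S : Set (ι → Bool), P.real S = ∑ a, P.real {a} * S.indicator (fun _ => 1) a := by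
    intro S
    have hS' : S = ((Finset.univ.filter (· ∈ S) : Finset (ι → Bool)) : Set (ι → Bool)) := by
      ext; simp
    conv_lhs => rw [hS', ← sum_measureReal_singleton]
    rw [Finset.sum_filter]
    refine Finset.sum_congr rfl fun a _ => ?_
    by_cases ha : a ∈ S <;> simp [ha]
  have hμ : ∀ a : ι → Bool, P.real {a} = ∏ i, m.real {a i} := by
    intro a
    rw [measureReal_def, hP, Measure.pi_singleton, ENNReal.toReal_prod]
    rfl
  have hmono : ∀ {S : Set (ι → Bool)}, IsUpperSet S →
      Monotone (S.indicator (fun _ => (1 : ℝ))) := by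
    intro S hS a b hab
    by_cases ha : a ∈ S
    · simp [ha, hS hab ha]
    · simp only [Set.indicator, ha, if_false]
      split_ifs <;> norm_num
  have hnn : ∀ S : Set (ι → Bool), (0 : (ι → Bool) → ℝ) ≤ S.indicator (fun _ => (1 : ℝ)) :=
    fun S a => Set.indicator_nonneg (fun _ _ => zero_le_one) a
  have key := fkg (S.indicator fun _ => (1 : ℝ)) (T.indicator fun _ => (1 : ℝ))
    (fun a : ι → Bool => P.real {a}) (fun a => measureReal_nonneg) (hnn S) (hnn T) (hmono hS) (hmono hT) fun a b => by
      rw [hμ, hμ, hμ, hμ, ← Finset.prod_mul_distrib, ← Finset.prod_mul_distrib]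
      refine (Finset.prod_congr rfl fun i _ => ?_).le
      simp only [Pi.inf_apply, Pi.sup_apply]
      cases a i <;> cases b i <;> simp [mul_comm]
  rw [← hsum, ← hsum] at key
  have h1 : ∑ a : ι → Bool, P.real {a} = 1 := by
    simp
  have h2 : ∑ a, P.real {a} * (S.indicator (fun _ => (1 : ℝ)) a * T.indicator (fun _ => 1) a) =
      P.real (S ∩ T) := by
    rw [hsum]
    refine Finset.sum_congr rfl fun a _ => ?_
    rw [← Set.inter_indicator_mul]
    simp
  rwa [h1, one_mul, h2] at key

open Classical in
/-- The configuration that is minus outside of `F`. -/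
noncomputable def minusOutside (F : Finset V) (ω : F → Bool) (v : V) : Bool :=
  if h : v ∈ F then ω ⟨v, h⟩ else false

theorem minusOutside_restrict_eq_true {F : Finset V} {ω : V → Bool} {v : V} :
    minusOutside F (F.restrict ω) v = true ↔ v ∈ F ∧ ω v = true := by
  unfold minusOutside
  split_ifs with h <;> simp [h]

/-- The event that `U` is witnessed inside of `F`. -/
def within (F : Finset V) (U : Set (V → Bool)) : Set (V → Bool) :=
  F.restrict ⁻¹' (minusOutside F ⁻¹' U)

theorem Finitary.within_subset (hU : Finitary U) (F : Finset V) : within F U ⊆ U :=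
  fun _ hω => hU.upper (fun _ hv => (minusOutside_restrict_eq_true.1 hv).2) hω

theorem Finitary.within_mono (hU : Finitary U) : Monotone fun F => within F U := by
  intro F F' hF ω hω
  refine hU.upper (fun v hv => ?_) hω
  rw [minusOutside_restrict_eq_true] at hv ⊢
  exact ⟨hF hv.1, hv.2⟩

theorem Finitary.iUnion_within (hU : Finitary U) : ⋃ F, within F U = U := by
  refine Set.Subset.antisymm (Set.iUnion_subset hU.within_subset) fun ω hω => ?_
  obtain ⟨F, h1, h2⟩ := hU ω hω
  refine Set.mem_iUnion.2 ⟨F, h2 _ fun v hv => ?_⟩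
  rw [minusOutside_restrict_eq_true]
  exact ⟨hv, h1 v hv⟩

theorem siteMeasure_within (p : unitInterval) (F : Finset V) (U : Set (V → Bool)) :
    (siteMeasure V p).real (within F U) =
      (Measure.pi fun _ : F => bernoulliMeasure true false p).real (minusOutside F ⁻¹' U) := by
  rw [within, measureReal_def, measureReal_def,
    ← Measure.map_apply (Finset.measurable_restrict F) (Set.toFinite _).measurableSet,
    siteMeasure, Measure.infinitePi_map_restrict]

theorem Finitary.tendsto_within [Countable V] (hU : Finitary U) (p : unitInterval) :
    Tendsto (fun F => (siteMeasure V p).real (within F U)) atTop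
      (𝓝 ((siteMeasure V p).real U)) := by
  have h := tendsto_measure_iUnion_atTop (μ := siteMeasure V p) hU.within_mono
  rw [hU.iUnion_within] at h
  exact (ENNReal.tendsto_toReal (measure_ne_top _ _)).comp h

/-- The **Harris inequality** for events witnessed by finitely many plus spins. -/
theorem Finitary.harris [Countable V] (hU : Finitary U) (hT : Finitary T) (p : unitInterval) :
    (siteMeasure V p).real U * (siteMeasure V p).real T ≤ (siteMeasure V p).real (U ∩ T) := by
  -- Finitary events are exhausted from inside by events in finite windows, where the finite
  -- inequality applies.
  refine le_of_tendsto ((hU.tendsto_within p).mul (hT.tendsto_within p))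
    (Eventually.of_forall fun F => ?_)
  have hup : ∀ {W : Set (V → Bool)}, Finitary W → IsUpperSet (minusOutside F ⁻¹' W) := by
    intro W hW a b hab ha
    refine hW.upper (fun v hv => ?_) ha
    unfold minusOutside at hv ⊢
    split_ifs at hv ⊢ with h
    exact hab ⟨v, h⟩ hv
  rw [siteMeasure_within, siteMeasure_within]
  refine (harris_fintype _ (hup hU) (hup hT)).trans ?_
  rw [← Set.preimage_inter, ← siteMeasure_within]
  exact measureReal_mono fun ω hω => ⟨hU.within_subset F hω.1, hT.within_subset F hω.2⟩

/-- Having an infinite cluster is not witnessed by finitely many spins, but it is a decreasing limit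
of such events, `farFrom`. -/
theorem Finitary.harris_iInter [Countable V] {W : ℕ → Set (V → Bool)} (hW : ∀ k, Finitary (W k))
    (hanti : Antitone W) (hT : Finitary T) (p : unitInterval) :
    (siteMeasure V p).real (⋂ k, W k) * (siteMeasure V p).real T ≤
      (siteMeasure V p).real ((⋂ k, W k) ∩ T) := by
  have h1 : Tendsto (fun k => (siteMeasure V p).real (W k)) atTop
      (𝓝 ((siteMeasure V p).real (⋂ k, W k))) :=
    (ENNReal.tendsto_toReal (measure_ne_top _ _)).comp (tendsto_measure_iInter_atTop
      (fun k => (hW k).measurableSet.nullMeasurableSet) hanti ⟨0, measure_ne_top _ _⟩)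
  have h2 : Tendsto (fun k => (siteMeasure V p).real (W k ∩ T)) atTop
      (𝓝 ((siteMeasure V p).real (⋂ k, W k ∩ T))) :=
    (ENNReal.tendsto_toReal (measure_ne_top _ _)).comp (tendsto_measure_iInter_atTop
      (fun k => ((hW k).measurableSet.inter hT.measurableSet).nullMeasurableSet)
      (fun k l hkl => Set.inter_subset_inter_left _ (hanti hkl)) ⟨0, measure_ne_top _ _⟩)
  rw [← Set.iInter_inter] at h2
  exact le_of_tendsto_of_tendsto' (h1.mul_const _) h2 fun k => (hW k).harris hT p

/-- The event that some site of a finite set has an infinite cluster. -/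
def infiniteFrom (G : SimpleGraph V) (S : Finset V) : Set (V → Bool) :=
  {ω | ∃ x ∈ S, (cluster G ω x).Infinite}

/-- The event that a finite set is connected to sites with a large code. -/
def farFrom [Encodable V] (G : SimpleGraph V) (S : Finset V) (k : ℕ) : Set (V → Bool) :=
  {ω | ∃ x ∈ S, ∃ y, k ≤ Encodable.encode y ∧ y ∈ cluster G ω x}

theorem finitary_farFrom [Encodable V] (G : SimpleGraph V) (S : Finset V) (k : ℕ) :
    Finitary (farFrom G S k) := by
  rintro ω ⟨x, hx, y, hy, h⟩
  obtain ⟨F, h1, h2⟩ := exists_finset_of_mem_cluster h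
  exact ⟨F, h1, fun ω' h' => ⟨x, hx, y, hy, h2 ω' h'⟩⟩

theorem antitone_farFrom [Encodable V] (G : SimpleGraph V) (S : Finset V) :
    Antitone (farFrom G S) := by
  rintro k l hkl ω ⟨x, hx, y, hy, h⟩
  exact ⟨x, hx, y, hkl.trans hy, h⟩

theorem iInter_farFrom [Encodable V] (G : SimpleGraph V) (S : Finset V) :
    ⋂ k, farFrom G S k = infiniteFrom G S := by
  ext ω
  rw [Set.mem_iInter]
  constructor
  · intro h
    by_contra hcon
    simp only [infiniteFrom, Set.mem_ofPred_eq, not_exists, not_and, Set.not_infinite] at hcon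
    have hfin : (⋃ x ∈ S, cluster G ω x).Finite := S.finite_toSet.biUnion fun x hx => hcon x hx
    obtain ⟨k, hk⟩ := (hfin.image Encodable.encode).bddAbove
    obtain ⟨x, hx, y, hy, hxy⟩ := h (k + 1)
    have := hk ⟨y, Set.mem_biUnion (Finset.mem_coe.2 hx) hxy, rfl⟩
    omega
  · rintro ⟨x, hx, hinf⟩ k
    obtain ⟨y, hy, hyk⟩ := hinf.exists_notMem_finite
      ((Set.finite_lt_nat k).preimage Encodable.encode_injective.injOn)
    exact ⟨x, hx, y, not_lt.1 hyk, hy⟩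

theorem harris_infiniteFrom [Encodable V] (G : SimpleGraph V) (S : Finset V) (hT : Finitary T)
    (p : unitInterval) :
    (siteMeasure V p).real (infiniteFrom G S) * (siteMeasure V p).real T ≤
      (siteMeasure V p).real (infiniteFrom G S ∩ T) := by
  rw [← iInter_farFrom]
  exact Finitary.harris_iInter (finitary_farFrom G S) (antitone_farFrom G S) hT p

theorem measurableSet_infiniteFrom [Encodable V] (G : SimpleGraph V) (S : Finset V) :
    MeasurableSet (infiniteFrom G S) := by
  rw [← iInter_farFrom]
  exact MeasurableSet.iInter fun k => (finitary_farFrom G S k).measurableSet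

/-- Marginals of the Bernoulli product measure. -/
theorem siteMeasure_map {V W : Type} {f : V → W} (hf : Function.Injective f) (p : unitInterval) :
    (siteMeasure W p).map (fun σ v => σ (f v)) = siteMeasure V p := by
  classical
  refine Measure.eq_infinitePi _ fun s t ht => ?_
  have hmeas : Measurable fun (σ : W → Bool) v => σ (f v) :=
    measurable_pi_lambda _ fun v => measurable_pi_apply _
  rw [Measure.map_apply hmeas (MeasurableSet.pi s.countable_toSet fun i _ => ht i)]
  have : (fun (σ : W → Bool) v => σ (f v)) ⁻¹' (s : Set V).pi t =
      ((s.map ⟨f, hf⟩ : Finset W) : Set W).pi (Function.extend f t fun _ => Set.univ) := by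
    ext σ
    simp [Set.mem_pi, hf.extend_apply]
  rw [this, siteMeasure, Measure.infinitePi_pi _ fun i hi => ?_]
  · simp [hf.extend_apply]
  · exact (Set.toFinite _).measurableSet

theorem siteMeasure_preimage {V W : Type} {f : V → W} (hf : Function.Injective f)
    (p : unitInterval) {U : Set (V → Bool)} (hU : MeasurableSet U) :
    (siteMeasure W p).real {σ | (fun v => σ (f v)) ∈ U} = (siteMeasure V p).real U := by
  have hmeas : Measurable fun (σ : W → Bool) v => σ (f v) :=
    measurable_pi_lambda _ fun v => measurable_pi_apply _
  rw [← siteMeasure_map hf p, map_measureReal_apply hmeas hU]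
  rfl

end Harris

/-! ### Comparison of the percolation and connectivity functions -/

theorem HexSite.B_injective : Function.Injective HexSite.B := fun a b h => by simpa using h

theorem tau_eq (p : unitInterval) (x y : ℤ × ℤ) :
    tau p x y = (siteMeasure (ℤ × ℤ) p).real {ω | y ∈ cluster triGraph ω x} := rfl

theorem theta_eq (p : unitInterval) (x : ℤ × ℤ) :
    theta p x = (siteMeasure (ℤ × ℤ) p).real (infiniteFrom triGraph {x}) := by
  simp [theta, percProb, infiniteFrom]

theorem pow_le_allPlus (p : unitInterval) (F : Finset (ℤ × ℤ)) {k : ℕ} (hF : F.card ≤ k) :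
    (p : ℝ) ^ k ≤ (siteMeasure (ℤ × ℤ) p).real (allPlus F) := by
  rw [siteMeasure_allPlus]
  exact pow_le_pow_of_le_one p.2.1 p.2.2 hF

theorem card_near_union_le (x y : HexSite) : (x.near ∪ y.near).card ≤ 6 :=
  (Finset.card_union_le _ _).trans (by have := x.card_near_le; have := y.card_near_le; omega)

theorem nearPlus_of_allPlus {β : ℤ × ℤ → Bool} {x : HexSite} {F : Finset (ℤ × ℤ)}
    (h : β ∈ allPlus F) (hF : x.near ⊆ F) : NearPlus β x := fun z hz => h z (hF hz)

/-- Harris, applied to the initial connection and to both hexagons being plus, at most six sites in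
all. The event at time `n` enters only through an inclusion, so its measurability plays no role. -/
theorem tau_le_tauAt (p : unitInterval) {n : ℕ∞} (hn : 1 ≤ n) (x y : HexSite) :
    (p : ℝ) ^ 6 * tau p x.base y.base ≤ tauAt p n x y := by
  have h1 := (finitary_connected triGraph x.base y.base).harris
    (finitary_allPlus (x.near ∪ y.near)) p
  have h2 := pow_le_allPlus p (x.near ∪ y.near) (card_near_union_le x y)
  have h3 := siteMeasure_preimage HexSite.B_injective p
    ((finitary_connected triGraph x.base y.base).measurableSet.inter
      (measurableSet_allPlus (x.near ∪ y.near)))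
  have h4 : (siteMeasure HexSite p).real {σ | (fun v => σ (HexSite.B v)) ∈
      {ω | y.base ∈ cluster triGraph ω x.base} ∩ allPlus (x.near ∪ y.near)} ≤ tauAt p n x y := by
    refine measureReal_mono ?_
    rintro σ ⟨h, hF⟩
    exact connected_stateAt hn (nearPlus_of_allPlus hF Finset.subset_union_left)
      (nearPlus_of_allPlus hF Finset.subset_union_right) h
  rw [← tau_eq] at h1
  have h0 : 0 ≤ tau p x.base y.base := measureReal_nonneg
  nlinarith

/-- A connection at time `n` forces one between the two hexagons initially. If both hexagons are
plus as well, it extends to the base points. -/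
theorem tauAt_le_tau (p : unitInterval) {n : ℕ∞} (hn : 1 ≤ n) (x y : HexSite) :
    (p : ℝ) ^ 6 * tauAt p n x y ≤ tau p x.base y.base := by
  set U : Set (ℤ × ℤ → Bool) :=
    ⋃ x' : x.near, ⋃ y' : y.near, {ω | (y' : ℤ × ℤ) ∈ cluster triGraph ω x'} with hU
  have hUf : Finitary U :=
    Finitary.iUnion fun x' => Finitary.iUnion fun y' => finitary_connected _ _ _
  have h1 := hUf.harris (finitary_allPlus (x.near ∪ y.near)) p
  have h2 := pow_le_allPlus p (x.near ∪ y.near) (card_near_union_le x y)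
  have h3 : tauAt p n x y ≤ (siteMeasure (ℤ × ℤ) p).real U := by
    rw [← siteMeasure_preimage HexSite.B_injective p hUf.measurableSet]
    refine measureReal_mono fun σ hσ => ?_
    obtain ⟨x', hx', y', hy', h⟩ := exists_near_connected_stateAt hn hσ
    exact Set.mem_iUnion.2 ⟨⟨x', hx'⟩, Set.mem_iUnion.2 ⟨⟨y', hy'⟩, h⟩⟩
  have h4 : (siteMeasure (ℤ × ℤ) p).real (U ∩ allPlus (x.near ∪ y.near)) ≤
      tau p x.base y.base := by
    refine measureReal_mono ?_
    rintro β ⟨h, hF⟩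
    obtain ⟨⟨x', hx'⟩, h⟩ := Set.mem_iUnion.1 h
    obtain ⟨⟨y', hy'⟩, h⟩ := Set.mem_iUnion.1 h
    exact mem_cluster_trans
      (near_connected (nearPlus_of_allPlus hF Finset.subset_union_left) x.base_mem_near hx')
      (mem_cluster_trans h
        (near_connected (nearPlus_of_allPlus hF Finset.subset_union_right) hy' y.base_mem_near))
  have h0 : 0 ≤ tauAt p n x y := measureReal_nonneg
  have h5 : 0 ≤ (siteMeasure (ℤ × ℤ) p).real (allPlus (x.near ∪ y.near)) := measureReal_nonneg
  have h6 : (0 : ℝ) ≤ (p : ℝ) ^ 6 := pow_nonneg p.2.1 6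
  nlinarith [mul_le_mul h3 h2 h6 (h0.trans h3)]

theorem theta_le_thetaAt (p : unitInterval) {n : ℕ∞} (hn : 1 ≤ n) (x : HexSite) :
    (p : ℝ) ^ 3 * theta p x.base ≤ thetaAt p n x := by
  have h1 := harris_infiniteFrom triGraph {x.base} (finitary_allPlus x.near) p
  have h2 := pow_le_allPlus p x.near x.card_near_le
  have h3 := siteMeasure_preimage HexSite.B_injective p
    ((measurableSet_infiniteFrom triGraph {x.base}).inter (measurableSet_allPlus x.near))
  have h4 : (siteMeasure HexSite p).real {σ | (fun v => σ (HexSite.B v)) ∈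
      infiniteFrom triGraph {x.base} ∩ allPlus x.near} ≤ thetaAt p n x := by
    refine measureReal_mono ?_
    rintro σ ⟨⟨x', hx', h⟩, hF⟩
    rw [Finset.mem_singleton] at hx'
    subst hx'
    exact infinite_stateAt hn hF h
  rw [← theta_eq] at h1
  have h0 : 0 ≤ theta p x.base := measureReal_nonneg
  nlinarith

theorem thetaAt_le_theta (p : unitInterval) {n : ℕ∞} (hn : 1 ≤ n) (x : HexSite) :
    (p : ℝ) ^ 3 * thetaAt p n x ≤ theta p x.base := by
  have h1 := harris_infiniteFrom triGraph x.near (finitary_allPlus x.near) p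
  have h2 := pow_le_allPlus p x.near x.card_near_le
  have h3 : thetaAt p n x ≤ (siteMeasure (ℤ × ℤ) p).real (infiniteFrom triGraph x.near) := by
    rw [← siteMeasure_preimage HexSite.B_injective p (measurableSet_infiniteFrom _ _)]
    refine measureReal_mono fun σ hσ => ?_
    obtain ⟨x', hx', h⟩ := exists_near_infinite hn hσ
    exact ⟨x', hx', h⟩
  have h4 : (siteMeasure (ℤ × ℤ) p).real (infiniteFrom triGraph x.near ∩ allPlus x.near) ≤
      theta p x.base := by
    refine measureReal_mono ?_
    rintro β ⟨⟨x', hx', h⟩, hF⟩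
    exact h.mono fun y hy =>
      mem_cluster_trans (near_connected (x := x) hF x.base_mem_near hx') hy
  have h0 : 0 ≤ thetaAt p n x := measureReal_nonneg
  have h6 : (0 : ℝ) ≤ (p : ℝ) ^ 3 := pow_nonneg p.2.1 3
  nlinarith [mul_le_mul h3 h2 h6 (h0.trans h3)]

/-! ### The connectivity function of the triangular lattice -/

theorem tau_mul_le (p : unitInterval) (x y z : ℤ × ℤ) : tau p x y * tau p y z ≤ tau p x z := by
  refine ((finitary_connected triGraph x y).harris (finitary_connected triGraph y z) p).trans ?_
  refine measureReal_mono ?_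
  rintro ω ⟨h1, h2⟩
  exact mem_cluster_trans h1 h2

theorem tau_le_one (p : unitInterval) (x y : ℤ × ℤ) : tau p x y ≤ 1 := measureReal_le_one

theorem triGraph_adj_add {z w : ℤ × ℤ} (v : ℤ × ℤ) (h : triGraph.Adj z w) :
    triGraph.Adj (z + v) (w + v) := by
  obtain ⟨hne, c, hzc, hcw⟩ := h
  obtain ⟨k, hk⟩ := hzc.symm
  obtain ⟨l, hl⟩ := hcw
  have hkl : k ≠ l := by
    rintro rfl
    rw [hk] at hl
    cases hl
    exact hne rfl
  rcases c with ⟨i, j⟩ | c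
  · obtain ⟨a, b⟩ := v
    refine triGraph_adj_of_nbr (x := HexSite.A (i + a, j + b)) hkl ?_ ?_
    · rcases z with ⟨z1, z2⟩
      fin_cases k <;> simp [HexSite.nbr] at hk ⊢ <;> omega
    · rcases w with ⟨w1, w2⟩
      fin_cases l <;> simp [HexSite.nbr] at hl ⊢ <;> omega
  · have := HexSite.isA_nbr (HexSite.B c) k
    rw [hk] at this
    simp [HexSite.isA] at this

theorem mem_cluster_translate {ω : ℤ × ℤ → Bool} {x y : ℤ × ℤ} (v : ℤ × ℤ)
    (h : y ∈ cluster triGraph (fun z => ω (z + v)) x) : y + v ∈ cluster triGraph ω (x + v) := by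
  have hx : ω (x + v) = true := plus_left_of_mem_cluster (ω := fun z => ω (z + v)) h
  exact cluster_induction (motive := fun y => y + v ∈ cluster triGraph ω (x + v)) h
    (mem_cluster_self hx) fun a b ha h1 hab h2 =>
      mem_cluster_trans ha (mem_cluster_of_adj h1 h2 (triGraph_adj_add v hab))

theorem tau_le_tau_add (p : unitInterval) (x y v : ℤ × ℤ) :
    tau p x y ≤ tau p (x + v) (y + v) := by
  rw [tau_eq, ← siteMeasure_preimage (add_left_injective v) p
    (finitary_connected triGraph x y).measurableSet]
  exact measureReal_mono fun ω hω => mem_cluster_translate v hω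

theorem tau_eq_tau_zero (p : unitInterval) (x y : ℤ × ℤ) : tau p x y = tau p 0 (y - x) := by
  refine le_antisymm ?_ ?_
  · simpa [sub_eq_add_neg] using tau_le_tau_add p x y (-x)
  · simpa using tau_le_tau_add p 0 (y - x) x

theorem tau_adj (p : unitInterval) {x y : ℤ × ℤ} (h : triGraph.Adj x y) :
    (p : ℝ) ^ 2 ≤ tau p x y := by
  refine (pow_le_allPlus p {x, y} Finset.card_le_two).trans (measureReal_mono fun ω hω => ?_)
  exact mem_cluster_of_adj (hω x (by simp)) (hω y (by simp)) h

theorem tau_self (p : unitInterval) (x : ℤ × ℤ) : (p : ℝ) ^ 2 ≤ tau p x x := by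
  refine (pow_le_allPlus p {x} (by simp)).trans (measureReal_mono fun ω hω => ?_)
  exact mem_cluster_self (hω x (by simp))

theorem triGraph_adj_zero :
    triGraph.Adj 0 (1, 0) ∧ triGraph.Adj 0 (-1, 0) ∧ triGraph.Adj 0 (0, 1) ∧
      triGraph.Adj 0 (0, -1) := by
  have h1 : triGraph.Adj (0 : ℤ × ℤ) (1, 0) :=
    triGraph_adj_of_nbr (x := HexSite.A (0, 0)) (k := 0) (l := 1) (by decide) rfl rfl
  have h2 : triGraph.Adj (0 : ℤ × ℤ) (0, 1) :=
    triGraph_adj_of_nbr (x := HexSite.A (0, 0)) (k := 0) (l := 2) (by decide) rfl rfl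
  have h3 := (triGraph_adj_add (-1, 0) h1).symm
  have h4 := (triGraph_adj_add (0, -1) h2).symm
  simp only [Prod.mk_add_mk, zero_add, add_neg_cancel, add_zero] at h3 h4
  exact ⟨h1, h3, h2, h4⟩

/-- Unit steps along the two axes, chained by `tau_mul_le`. This a priori exponential bound keeps
`-log τ` at most linear in the distance. -/
theorem tau_lower (p : unitInterval) (i j : ℤ) :
    (p : ℝ) ^ (2 * (i.natAbs + j.natAbs + 2)) ≤ tau p 0 (i, j) := by
  have hp0 : (0 : ℝ) ≤ p := p.2.1
  have hline : ∀ e : ℤ × ℤ, triGraph.Adj 0 e → ∀ k : ℕ,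
      (p : ℝ) ^ (2 * (k + 1)) ≤ tau p 0 (k • e) := by
    intro e he k
    induction k with
    | zero => simpa using tau_self p 0
    | succ k ih =>
      have h1 := tau_mul_le p 0 (k • e) ((k + 1) • e)
      have h2 : (p : ℝ) ^ 2 ≤ tau p (k • e) ((k + 1) • e) := by
        rw [tau_eq_tau_zero, add_smul, one_smul, add_sub_cancel_left]
        exact tau_adj p he
      calc (p : ℝ) ^ (2 * (k + 1 + 1)) = p ^ (2 * (k + 1)) * p ^ 2 := by ring
        _ ≤ tau p 0 (k • e) * tau p (k • e) ((k + 1) • e) :=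
          mul_le_mul ih h2 (by positivity) measureReal_nonneg
        _ ≤ _ := h1
  obtain ⟨a1, a2, a3, a4⟩ := triGraph_adj_zero
  have hi : (p : ℝ) ^ (2 * (i.natAbs + 1)) ≤ tau p 0 (i, 0) := by
    rcases Int.natAbs_eq i with h | h
    · have := hline _ a1 i.natAbs
      rwa [show i.natAbs • ((1, 0) : ℤ × ℤ) = (i, 0) from Prod.ext (by simpa using h.symm) (by simp)] at this
    · have := hline _ a2 i.natAbs
      rwa [show i.natAbs • ((-1, 0) : ℤ × ℤ) = (i, 0) from Prod.ext (by simpa using h.symm) (by simp)] at this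
  have hj : (p : ℝ) ^ (2 * (j.natAbs + 1)) ≤ tau p 0 (0, j) := by
    rcases Int.natAbs_eq j with h | h
    · have := hline _ a3 j.natAbs
      rwa [show j.natAbs • ((0, 1) : ℤ × ℤ) = (0, j) from Prod.ext (by simp) (by simpa using h.symm)] at this
    · have := hline _ a4 j.natAbs
      rwa [show j.natAbs • ((0, -1) : ℤ × ℤ) = (0, j) from Prod.ext (by simp) (by simpa using h.symm)] at this
  have h1 := tau_mul_le p 0 (i, 0) (i, j)
  rw [tau_eq_tau_zero p (i, 0), show ((i, j) : ℤ × ℤ) - (i, 0) = (0, j) by ext <;> simp] at h1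
  calc (p : ℝ) ^ (2 * (i.natAbs + j.natAbs + 2))
      = p ^ (2 * (i.natAbs + 1)) * p ^ (2 * (j.natAbs + 1)) := by ring
    _ ≤ tau p 0 (i, 0) * tau p 0 (0, j) := mul_le_mul hi hj (by positivity) measureReal_nonneg
    _ ≤ _ := h1


/-! ### Directional limits of subadditive functions -/

section Subadditive

variable {V E : Type*} [AddCommGroup V] [NormedAddCommGroup E] [NormedSpace ℝ E]

/-- Going to infinity in the direction `u`. -/
noncomputable def alongDirection (pos : V → E) (u : E) : Filter V :=
  comap (fun v => ‖pos v‖) atTop ⊓ comap (fun v => ‖pos v‖⁻¹ • pos v) (𝓝 u)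

/-- Fekete's argument in a fixed direction. Write `w` as `k • v` plus a remainder with `k = ⌊‖pos w‖
/ ‖pos v‖⌋₊`. As `v` and `w` point almost the same way, the remainder has length at most `2 * δ *
‖pos w‖ + ‖pos v‖`, and `hbound` makes it cheap. With the chosen `δ`, the first term accounts for
half of `ε`; taking `w` far enough makes the rest fit in the other half. -/
theorem subadditive_step (pos : V →+ E) (u : E) {a : V → ℝ} {C : ℝ} (hC : 0 < C)
    (hsub : ∀ v w, a (v + w) ≤ a v + a w) (h0 : ∀ v, 0 ≤ a v)
    (hbound : ∀ v, a v ≤ C * (‖pos v‖ + 1)) {ε : ℝ} (hε : 0 < ε) :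
    ∀ᶠ v in alongDirection pos u, ∀ᶠ w in alongDirection pos u,
      a w / ‖pos w‖ ≤ a v / ‖pos v‖ + ε := by
  set δ := ε / (4 * C) with hδ
  have hδ0 : 0 < δ := by positivity
  have hdir : ∀ᶠ v in alongDirection pos u, ‖‖pos v‖⁻¹ • pos v - u‖ < δ := by
    have h : ∀ᶠ d in 𝓝 u, ‖d - u‖ < δ := by
      filter_upwards [Metric.ball_mem_nhds u hδ0] with d hd
      rwa [Metric.mem_ball, dist_eq_norm] at hd
    exact (tendsto_comap.mono_left inf_le_right).eventually h
  have hfar : ∀ M : ℝ, ∀ᶠ v in alongDirection pos u, M ≤ ‖pos v‖ := fun M =>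
    (tendsto_comap.mono_left inf_le_left).eventually (eventually_ge_atTop M)
  have hmul : ∀ (k : ℕ) (x v : V), a (x + k • v) ≤ a x + k * a v := by
    intro k x v
    induction k with
    | zero => simp
    | succ k ih =>
      have := hsub (x + k • v) v
      rw [add_smul, one_smul, ← add_assoc]
      push_cast
      linarith
  filter_upwards [hdir, hfar 1] with v hv hv1
  filter_upwards [hdir, hfar 1, hfar (2 * C * (‖pos v‖ + 1) / ε)] with w hw hw1 hw2
  have hvpos : 0 < ‖pos v‖ := by linarith
  have hwpos : 0 < ‖pos w‖ := by linarith
  set k := ⌊‖pos w‖ / ‖pos v‖⌋₊ with hk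
  have hk1 : k * ‖pos v‖ ≤ ‖pos w‖ := by
    rw [← le_div_iff₀ hvpos]
    exact Nat.floor_le (by positivity)
  have hk2 : ‖pos w‖ ≤ (k + 1) * ‖pos v‖ := by
    rw [← div_le_iff₀ hvpos]
    exact (Nat.lt_floor_add_one _).le
  have hpos : ‖pos (w - k • v)‖ ≤ ‖pos w‖ * (2 * δ) + ‖pos v‖ := by
    have e : pos (w - k • v) = ‖pos w‖ • ((‖pos w‖⁻¹ • pos w - u) - (‖pos v‖⁻¹ • pos v - u)) +
        (‖pos w‖ - k * ‖pos v‖) • (‖pos v‖⁻¹ • pos v) := by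
      rw [map_sub, map_nsmul, sub_sub_sub_cancel_right, smul_sub, smul_inv_smul₀ hwpos.ne',
        sub_smul, mul_smul, smul_inv_smul₀ hvpos.ne', Nat.cast_smul_eq_nsmul]
      abel
    rw [e]
    refine (norm_add_le _ _).trans (add_le_add ?_ ?_)
    · rw [norm_smul, norm_norm]
      refine mul_le_mul_of_nonneg_left ((norm_sub_le _ _).trans ?_) hwpos.le
      linarith
    · rw [norm_smul, norm_smul, norm_inv, norm_norm, inv_mul_cancel₀ hvpos.ne', mul_one,
        Real.norm_eq_abs, abs_of_nonneg (by linarith)]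
      linarith
  have ha := hmul k (w - k • v) v
  rw [sub_add_cancel] at ha
  have hb := hbound (w - k • v)
  have hc : a w ≤ C * (‖pos w‖ * (2 * δ) + ‖pos v‖ + 1) + k * a v :=
    ha.trans (add_le_add (hb.trans (mul_le_mul_of_nonneg_left (by linarith) hC.le)) le_rfl)
  have hkv : k * a v ≤ ‖pos w‖ * (a v / ‖pos v‖) := by
    rw [mul_div_assoc', le_div_iff₀ hvpos]
    nlinarith [h0 v]
  have hC1 : C * (‖pos w‖ * (2 * δ)) = ‖pos w‖ * (ε / 2) := by
    rw [hδ]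
    field_simp
    ring
  have hC2 : C * (‖pos v‖ + 1) ≤ ‖pos w‖ * (ε / 2) := by
    rw [div_le_iff₀ hε] at hw2
    linarith
  rw [div_le_iff₀ hwpos]
  nlinarith

theorem exists_tendsto_of_subadditive (pos : V →+ E) (u : E) {a : V → ℝ} {C : ℝ} (hC : 0 < C)
    (hsub : ∀ v w, a (v + w) ≤ a v + a w) (h0 : ∀ v, 0 ≤ a v)
    (hbound : ∀ v, a v ≤ C * (‖pos v‖ + 1)) :
    ∃ L : ℝ, 0 ≤ L ∧ Tendsto (fun v => a v / ‖pos v‖) (alongDirection pos u) (𝓝 L) := by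
  set F := alongDirection pos u with hF
  -- The filter is trivial when no elements go to infinity in the direction `u`, for instance if `u`
  -- is not a unit vector; any limit then serves.
  rcases F.eq_or_neBot with hbot | hne
  · exact ⟨0, le_rfl, by rw [hbot]; exact tendsto_bot⟩
  set f : V → ℝ := fun v => a v / ‖pos v‖ with hf
  have hf0 : ∀ v, 0 ≤ f v := fun v => div_nonneg (h0 v) (norm_nonneg _)
  have hf1 : ∀ᶠ v in F, f v ≤ 2 * C := by
    have hfar : ∀ᶠ v in F, 1 ≤ ‖pos v‖ :=
      (tendsto_comap.mono_left inf_le_left).eventually (eventually_ge_atTop 1)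
    filter_upwards [hfar] with v hv
    rw [hf, div_le_iff₀ (by linarith)]
    nlinarith [hbound v]
  have hb : F.IsBoundedUnder (· ≤ ·) f := ⟨2 * C, by simpa using hf1⟩
  have hb' : F.IsBoundedUnder (· ≥ ·) f := ⟨0, by simpa using Eventually.of_forall hf0⟩
  have hle : limsup f F ≤ liminf f F := by
    refine le_of_forall_pos_le_add fun ε hε => ?_
    rw [← sub_le_iff_le_add]
    refine le_liminf_of_le hb.isCoboundedUnder_ge ?_
    filter_upwards [subadditive_step pos u hC hsub h0 hbound hε] with v hv
    rw [sub_le_iff_le_add]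
    exact limsup_le_of_le hb'.isCoboundedUnder_le hv
  have hlim : Tendsto f F (𝓝 (liminf f F)) :=
    tendsto_of_le_liminf_of_limsup_le le_rfl hle hb hb'
  exact ⟨_, ge_of_tendsto hlim (Eventually.of_forall hf0), hlim⟩

/-- Nearby vectors have nearby directions. -/
theorem norm_direction_sub_le (d d' : E) (hd : d ≠ 0) :
    ‖‖d'‖⁻¹ • d' - ‖d‖⁻¹ • d‖ ≤ 2 * ‖d' - d‖ / ‖d‖ := by
  have hd0 : 0 < ‖d‖ := norm_pos_iff.2 hd
  have e : ‖d'‖⁻¹ • d' - ‖d‖⁻¹ • d = ‖d‖⁻¹ • (d' - d) + (‖d'‖⁻¹ - ‖d‖⁻¹) • d' := by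
    rw [smul_sub, sub_smul]
    abel
  have h2 : ‖(‖d'‖⁻¹ - ‖d‖⁻¹) • d'‖ ≤ ‖d‖⁻¹ * ‖d' - d‖ := by
    rcases eq_or_ne d' 0 with rfl | hd'
    · rw [smul_zero, norm_zero]
      positivity
    have hd0' : 0 < ‖d'‖ := norm_pos_iff.2 hd'
    rw [norm_smul, Real.norm_eq_abs, ← abs_of_pos hd0', abs_norm, ← abs_of_pos hd0', ← abs_mul,
      abs_norm]
    have : (‖d'‖⁻¹ - ‖d‖⁻¹) * ‖d'‖ = ‖d‖⁻¹ * (‖d‖ - ‖d'‖) := by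
      field_simp
    rw [this, abs_mul, abs_of_pos (inv_pos.2 hd0)]
    refine mul_le_mul_of_nonneg_left ?_ (inv_pos.2 hd0).le
    rw [abs_sub_comm]
    exact abs_norm_sub_norm_le _ _
  rw [e]
  refine (norm_add_le _ _).trans ?_
  rw [norm_smul, norm_inv, norm_norm]
  calc _ ≤ ‖d‖⁻¹ * ‖d' - d‖ + ‖d‖⁻¹ * ‖d' - d‖ := by linarith
    _ = _ := by ring

end Subadditive

/-! ### Positions -/

/-- `triPos` as a homomorphism. -/
noncomputable def triPosHom : ℤ × ℤ →+ Plane where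
  toFun := triPos
  map_zero' := by
    ext i
    fin_cases i <;> simp [triPos]
  map_add' z w := by
    ext i
    fin_cases i <;> simp [triPos] <;> ring

theorem triPos_sub (z w : ℤ × ℤ) : triPos (z - w) = triPos z - triPos w :=
  map_sub triPosHom z w

theorem abs_add_abs_le_norm_triPos (z : ℤ × ℤ) : |(z.1 : ℝ)| + |(z.2 : ℝ)| ≤ 3 * ‖triPos z‖ := by
  have h0 : |√3 * ((z.1 : ℝ) + (z.2 : ℝ) / 2)| ≤ ‖triPos z‖ := by
    simpa [triPos] using PiLp.norm_apply_le (triPos z) 0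
  have h1 : 3 / 2 * |(z.2 : ℝ)| ≤ ‖triPos z‖ := by
    simpa [triPos] using PiLp.norm_apply_le (triPos z) 1
  have h3 : (1 : ℝ) ≤ √3 := by
    rw [Real.one_le_sqrt]
    norm_num
  rw [abs_mul, abs_of_pos (by linarith : (0 : ℝ) < √3)] at h0
  have h4 : |(z.1 : ℝ) + (z.2 : ℝ) / 2| ≤ ‖triPos z‖ := by
    nlinarith [abs_nonneg ((z.1 : ℝ) + (z.2 : ℝ) / 2)]
  have h5 : |(z.1 : ℝ)| ≤ |(z.1 : ℝ) + (z.2 : ℝ) / 2| + |(z.2 : ℝ)| / 2 := by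
    have := abs_sub ((z.1 : ℝ) + (z.2 : ℝ) / 2) ((z.2 : ℝ) / 2)
    rw [add_sub_cancel_right, abs_div, abs_two] at this
    exact this
  linarith [norm_nonneg (triPos z)]

theorem norm_hexPos_sub_base (x : HexSite) : ‖hexPos x - hexPos (HexSite.B x.base)‖ ≤ 1 := by
  rcases x with z | z
  · simp only [hexPos, HexSite.base, add_sub_cancel_left, EuclideanSpace.norm_eq,
      Fin.sum_univ_two]
    rw [Real.sqrt_le_one]
    simp [div_pow]
    norm_num
  · simp [HexSite.base]

theorem norm_triPos_base_sub_le (x y : HexSite) :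
    ‖(triPos y.base - triPos x.base) - (hexPos y - hexPos x)‖ ≤ 2 := by
  have hx := norm_hexPos_sub_base x
  have hy := norm_hexPos_sub_base y
  have e : (triPos y.base - triPos x.base) - (hexPos y - hexPos x) =
      (hexPos x - hexPos (HexSite.B x.base)) - (hexPos y - hexPos (HexSite.B y.base)) := by
    simp only [hexPos]
    abel
  rw [e]
  exact (norm_sub_le _ _).trans (by linarith)

/-- The pair of base points of a pair of sites. -/
def basePair (q : HexSite × HexSite) : (ℤ × ℤ) × (ℤ × ℤ) := (q.1.base, q.2.base)

theorem norm_basePair_sub_le (q : HexSite × HexSite) :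
    |‖triPos (basePair q).1 - triPos (basePair q).2‖ - ‖hexPos q.1 - hexPos q.2‖| ≤ 2 := by
  rw [norm_sub_rev (triPos _), norm_sub_rev (hexPos _)]
  exact (abs_norm_sub_norm_le _ _).trans (norm_triPos_base_sub_le q.1 q.2)

theorem tendsto_basePair_farPairs :
    Tendsto basePair (farPairs hexPos) (farPairs triPos) := by
  rw [farPairs, farPairs, tendsto_comap_iff]
  refine tendsto_atTop_mono (f := fun q : HexSite × HexSite => ‖hexPos q.1 - hexPos q.2‖ - 2)
    (fun q => ?_) (tendsto_atTop_add_const_right _ _ tendsto_comap)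
  have := (abs_le.1 (norm_basePair_sub_le q)).1
  simp only [Function.comp_apply]
  linarith

theorem tendsto_basePair_farPairsAlong (u : Plane) :
    Tendsto basePair (farPairsAlong hexPos u) (farPairsAlong triPos u) := by
  refine tendsto_inf.2 ⟨tendsto_basePair_farPairs.mono_left inf_le_left, ?_⟩
  rw [tendsto_comap_iff]
  have h1 : Tendsto (fun q : HexSite × HexSite =>
      ‖hexPos q.2 - hexPos q.1‖⁻¹ • (hexPos q.2 - hexPos q.1)) (farPairsAlong hexPos u) (𝓝 u) :=
    tendsto_comap.mono_left inf_le_right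
  have hfar : Tendsto (fun q : HexSite × HexSite => ‖hexPos q.2 - hexPos q.1‖)
      (farPairsAlong hexPos u) atTop := by
    refine Tendsto.congr (fun q => norm_sub_rev _ _) ((tendsto_comap
      (f := fun q : HexSite × HexSite => ‖hexPos q.1 - hexPos q.2‖)).mono_left inf_le_left)
  have h2 : Tendsto (fun q : HexSite × HexSite =>
      ‖triPos (basePair q).2 - triPos (basePair q).1‖⁻¹ •
        (triPos (basePair q).2 - triPos (basePair q).1) -
      ‖hexPos q.2 - hexPos q.1‖⁻¹ • (hexPos q.2 - hexPos q.1))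
      (farPairsAlong hexPos u) (𝓝 0) := by
    -- Passing to base points moves the difference vector by at most 2, and `norm_direction_sub_le`
    -- doubles this.
    refine squeeze_zero_norm' ?_ (hfar.const_div_atTop 4)
    filter_upwards [hfar.eventually (eventually_gt_atTop 0)] with q hq
    refine (norm_direction_sub_le _ _ (norm_pos_iff.1 hq)).trans ?_
    refine div_le_div_of_nonneg_right ?_ hq.le
    have := norm_triPos_base_sub_le q.1 q.2
    simp only [basePair]
    linarith
  have h3 := h1.add h2
  simp only [add_sub_cancel, add_zero] at h3
  exact h3

theorem tendsto_B_farPairs :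
    Tendsto (Prod.map HexSite.B HexSite.B) (farPairs triPos) (farPairs hexPos) := by
  rw [farPairs, farPairs, tendsto_comap_iff]
  exact tendsto_comap

/-! ### Correlation lengths -/

/-- The quantity whose limit is the inverse correlation length. -/
noncomputable def decayRate {V : Type} (pos : V → Plane) (τ : V → V → ℝ) (q : V × V) : ℝ :=
  -(1 / ‖pos q.1 - pos q.2‖ * Real.log (τ q.1 q.2))

/-- The added 1 in the constant keeps it positive at `p = 1`, as the subadditive limit requires. -/
theorem neg_log_tau_le {p : unitInterval} (hp : 0 < (p : ℝ)) (v : ℤ × ℤ) :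
    -Real.log (tau p 0 v) ≤ 6 * (-Real.log p + 1) * (‖triPos v‖ + 1) := by
  have hlog : Real.log p ≤ 0 := Real.log_nonpos hp.le p.2.2
  have h := Real.log_le_log (pow_pos hp _) (tau_lower p v.1 v.2)
  rw [Real.log_pow] at h
  have h2 := abs_add_abs_le_norm_triPos v
  push_cast [Nat.cast_natAbs, Int.cast_abs] at h
  have h3 : (0 : ℝ) ≤ ‖triPos v‖ := norm_nonneg _
  nlinarith

theorem tau_pos {p : unitInterval} (hp : 0 < (p : ℝ)) (x y : ℤ × ℤ) : 0 < tau p x y := by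
  rw [tau_eq_tau_zero]
  exact (pow_pos hp _).trans_le (tau_lower p (y - x).1 (y - x).2)

theorem exists_corrLength_tri {p : unitInterval} (hp : 0 < (p : ℝ)) (u : Plane) :
    ∃ ξ : ℝ≥0∞, IsCorrLength triPos (farPairsAlong triPos u) (tau p) ξ := by
  have hlog : Real.log p ≤ 0 := Real.log_nonpos hp.le p.2.2
  obtain ⟨L, hL, hlim⟩ := exists_tendsto_of_subadditive triPosHom u
    (a := fun v => -Real.log (tau p 0 v)) (C := 6 * (-Real.log p + 1)) (by linarith)
    (fun v w => by
      have h1 := tau_mul_le p 0 v (v + w)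
      rw [tau_eq_tau_zero p v, add_sub_cancel_left] at h1
      have h2 := Real.log_le_log (mul_pos (tau_pos hp 0 v) (tau_pos hp 0 w)) h1
      rw [Real.log_mul (tau_pos hp 0 v).ne' (tau_pos hp 0 w).ne'] at h2
      linarith)
    (fun v => neg_nonneg.2 (Real.log_nonpos (tau_pos hp 0 v).le (tau_le_one p 0 v)))
    (neg_log_tau_le hp)
  -- Since `L` is finite this is positive; it is `∞` exactly when there is no exponential decay, `L
  -- = 0`.
  refine ⟨(ENNReal.ofReal L)⁻¹, by simp, ?_⟩
  rw [inv_inv, ENNReal.toReal_ofReal hL]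
  have hsub : Tendsto (fun q : (ℤ × ℤ) × (ℤ × ℤ) => q.2 - q.1) (farPairsAlong triPos u)
      (alongDirection triPosHom u) := by
    refine tendsto_inf.2 ⟨?_, ?_⟩
    · rw [tendsto_comap_iff]
      refine Tendsto.congr (fun q => ?_) ((tendsto_comap (f := fun q : (ℤ × ℤ) × (ℤ × ℤ) =>
        ‖triPos q.1 - triPos q.2‖) (x := atTop)).mono_left inf_le_left)
      rw [norm_sub_rev, ← triPos_sub]
      rfl
    · rw [tendsto_comap_iff]
      refine Tendsto.congr (fun q => ?_) ((tendsto_comap (f := fun q : (ℤ × ℤ) × (ℤ × ℤ) =>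
        ‖triPos q.2 - triPos q.1‖⁻¹ • (triPos q.2 - triPos q.1))).mono_left inf_le_right)
      rw [← triPos_sub]
      rfl
  refine (hlim.comp hsub).congr fun q => ?_
  have : triPosHom (q.2 - q.1) = triPos q.2 - triPos q.1 := triPos_sub _ _
  simp only [Function.comp_apply]
  rw [this, norm_sub_rev, tau_eq_tau_zero p q.1]
  ring

theorem tauAt_pos {p : unitInterval} (hp : 0 < (p : ℝ)) {n : ℕ∞} (hn : 1 ≤ n) (x y : HexSite) :
    0 < tauAt p n x y :=
  (mul_pos (pow_pos hp 6) (tau_pos hp _ _)).trans_le (tau_le_tauAt p hn x y)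

theorem abs_log_tauAt_sub_le {p : unitInterval} (hp : 0 < (p : ℝ)) {n : ℕ∞} (hn : 1 ≤ n)
    (x y : HexSite) :
    |Real.log (tauAt p n x y) - Real.log (tau p x.base y.base)| ≤ 6 * -Real.log p := by
  have h1 := Real.log_le_log (mul_pos (pow_pos hp 6) (tau_pos hp _ _)) (tau_le_tauAt p hn x y)
  have h2 := Real.log_le_log (mul_pos (pow_pos hp 6) (tauAt_pos hp hn x y)) (tauAt_le_tau p hn x y)
  rw [Real.log_mul (pow_pos hp 6).ne' (tau_pos hp _ _).ne', Real.log_pow] at h1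
  rw [Real.log_mul (pow_pos hp 6).ne' (tauAt_pos hp hn x y).ne', Real.log_pow] at h2
  push_cast at h1 h2
  rw [abs_le]
  constructor <;> linarith

theorem tendsto_decayRate_sub {p : unitInterval} (hp : 0 < (p : ℝ)) {n : ℕ∞} (hn : 1 ≤ n) :
    Tendsto (fun q => decayRate hexPos (tauAt p n) q - decayRate triPos (tau p) (basePair q))
      (farPairs hexPos) (𝓝 0) := by
  have hlog : Real.log p ≤ 0 := Real.log_nonpos hp.le p.2.2
  set C := 6 * (-Real.log p + 1) with hC
  have hfar : Tendsto (fun q : HexSite × HexSite => ‖hexPos q.1 - hexPos q.2‖)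
      (farPairs hexPos) atTop := tendsto_comap
  -- The first term bounds the difference of the logarithms. The second is the change of distance,
  -- at most 2, times the triangular rate, at most `2 * C` once the triangular distance is at least
  -- 1; distance 3 on the hexagonal side ensures that.
  refine squeeze_zero_norm' ?_ (hfar.const_div_atTop (6 * -Real.log p + 4 * C))
  filter_upwards [hfar.eventually (eventually_ge_atTop 3)] with q hq
  have h1 := norm_basePair_sub_le q
  have h2 := abs_log_tauAt_sub_le hp hn q.1 q.2
  have h3 := neg_log_tau_le hp ((basePair q).2 - (basePair q).1)
  rw [← tau_eq_tau_zero, triPos_sub, norm_sub_rev] at h3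
  have h4 := Real.log_nonpos (tau_pos hp (basePair q).1 (basePair q).2).le (tau_le_one p _ _)
  unfold decayRate
  change |Real.log (tauAt p n q.1 q.2) - Real.log (tau p (basePair q).1 (basePair q).2)| ≤ _ at h2
  set D := ‖hexPos q.1 - hexPos q.2‖
  set D' := ‖triPos (basePair q).1 - triPos (basePair q).2‖
  set l := Real.log (tauAt p n q.1 q.2)
  set l' := Real.log (tau p (basePair q).1 (basePair q).2)
  have hD' : 1 ≤ D' := by
    have := (abs_le.1 h1).1
    linarith
  have hD0 : 0 < D := by linarith
  have hD0' : 0 < D' := by linarith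
  have e : -(1 / D * l) - -(1 / D' * l') = (-(l - l') + (-l' / D') * (D' - D)) / D := by
    field_simp
    ring
  rw [e, Real.norm_eq_abs, abs_div, abs_of_pos hD0]
  refine div_le_div_of_nonneg_right ((abs_add_le _ _).trans ?_) hD0.le
  rw [abs_neg, abs_mul]
  refine add_le_add h2 ?_
  have h5 : |-l' / D'| ≤ 2 * C := by
    rw [abs_of_nonneg (div_nonneg (by linarith) hD0'.le), div_le_iff₀ hD0']
    nlinarith
  nlinarith [abs_nonneg (D' - D), abs_nonneg (-l' / D')]

theorem IsCorrLength.hex {p : unitInterval} (hp : 0 < (p : ℝ)) {n : ℕ∞} (hn : 1 ≤ n)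
    {F : Filter (HexSite × HexSite)} {F' : Filter ((ℤ × ℤ) × (ℤ × ℤ))}
    (hF : F ≤ farPairs hexPos) (hF' : Tendsto basePair F F') {ξ : ℝ≥0∞}
    (h : IsCorrLength triPos F' (tau p) ξ) : IsCorrLength hexPos F (tauAt p n) ξ := by
  refine ⟨h.1, ?_⟩
  have h1 := ((tendsto_decayRate_sub hp hn).mono_left hF).add (h.2.comp hF')
  rw [zero_add] at h1
  refine h1.congr fun q => ?_
  simp [decayRate]

/-- Restrict to pairs in `ℬ`, which are their own base points. No directional version is needed, as
the triangular limit is known to exist in each direction. -/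
theorem IsCorrLength.tri {p : unitInterval} (hp : 0 < (p : ℝ)) {n : ℕ∞} (hn : 1 ≤ n)
    {ξ : ℝ≥0∞} (h : IsCorrLength hexPos (farPairs hexPos) (tauAt p n) ξ) :
    IsCorrLength triPos (farPairs triPos) (tau p) ξ := by
  refine ⟨h.1, ?_⟩
  have h1 := (h.2.comp tendsto_B_farPairs).sub ((tendsto_decayRate_sub hp hn).comp
    tendsto_B_farPairs)
  rw [sub_zero] at h1
  refine h1.congr fun q => ?_
  simp [decayRate, basePair, HexSite.base]

end Domany

end

theorem theorem3 :
    -- the limiting state exists almost surely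
    (∀ p : unitInterval, ∀ᵐ σ ∂(siteMeasure HexSite p),
      Tendsto (fun n : ℕ => state n σ) atTop (𝓝 (limitState σ))) ∧
    ∃ c₁ c₂ c₃ c₄ : ℝ, 0 < c₁ ∧ 0 < c₂ ∧ 0 < c₃ ∧ 0 < c₄ ∧
      ∀ n : ℕ∞, 1 ≤ n →
        (∀ x y : HexSite, ∃ x' y' : ℤ × ℤ,
          ‖hexPos x - hexPos (HexSite.B x')‖ ≤ 1 ∧ ‖hexPos y - hexPos (HexSite.B y')‖ ≤ 1 ∧
          (∀ p : unitInterval, 1 / 2 < (p : ℝ) →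
            c₁ * theta p x' ≤ thetaAt p n x ∧ thetaAt p n x ≤ c₂ * theta p x') ∧
          (∀ p : unitInterval, 0 < (p : ℝ) → (p : ℝ) ≤ 1 / 2 →
            (p : ℝ) ^ c₃ * tau p x' y' ≤ tauAt p n x y ∧
            tauAt p n x y ≤ (p : ℝ) ^ (-c₄) * tau p x' y')) ∧
        (∀ p : unitInterval, 0 < (p : ℝ) → (p : ℝ) ≤ 1 / 2 →
          -- the correlation lengths in every direction exist and agree
          (∀ u : Plane, ‖u‖ = 1 → ∃ ξ : ℝ≥0∞,
            IsCorrLength triPos (farPairsAlong triPos u) (tau p) ξ ∧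
            IsCorrLength hexPos (farPairsAlong hexPos u) (tauAt p n) ξ) ∧
          -- and so do the limits without restriction on the direction, if one of them exists
          (∀ ξ : ℝ≥0∞,
            IsCorrLength triPos (farPairs triPos) (tau p) ξ ↔
            IsCorrLength hexPos (farPairs hexPos) (tauAt p n) ξ)) := by
  -- For `p > 1/2` the cost `p ^ 3` of one plus hexagon exceeds `1 / 8`; the exponent 6 is the cost
  -- of two hexagons.
  refine ⟨fun p => Eventually.of_forall tendsto_state, 1 / 8, 8, 6, 6, by norm_num, by norm_num,
    by norm_num, by norm_num, fun n hn => ⟨fun x y => ⟨x.base, y.base, norm_hexPos_sub_base x,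
    norm_hexPos_sub_base y, fun p hp => ?_, fun p hp _ => ?_⟩, fun p hp _ =>
    ⟨fun u _ => ?_, fun ξ => ⟨fun h => h.hex hp hn le_rfl tendsto_basePair_farPairs,
      fun h => h.tri hp hn⟩⟩⟩⟩
  · have h3 : (1 / 8 : ℝ) ≤ (p : ℝ) ^ 3 := by
      have := pow_le_pow_left₀ (by norm_num) hp.le 3
      norm_num at this ⊢
      exact this
    have h1 := theta_le_thetaAt p hn x
    have h2 := thetaAt_le_theta p hn x
    have h4 : 0 ≤ theta p x.base := measureReal_nonneg
    have h5 : 0 ≤ thetaAt p n x := measureReal_nonneg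
    constructor <;> nlinarith
  · have e : (p : ℝ) ^ (6 : ℝ) = (p : ℝ) ^ 6 := by exact_mod_cast Real.rpow_natCast (p : ℝ) 6
    rw [Real.rpow_neg hp.le, e]
    refine ⟨tau_le_tauAt p hn x y, ?_⟩
    rw [inv_mul_eq_div, le_div_iff₀ (pow_pos hp 6), mul_comm]
    exact tauAt_le_tau p hn x y
  · obtain ⟨ξ, h⟩ := exists_corrLength_tri hp u
    exact ⟨ξ, h, h.hex hp hn inf_le_left (tendsto_basePair_farPairsAlong u)⟩
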